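/- A transformation group $(G,X)$ is a compact Hausdorff space $X$ together with a discrete group $G$ acting continuously on $X$. A nonempty subset $Y\subseteq X$ is invariant if $GY\subseteq Y$. For a closed invariant subset $Y$ of $(G,X)$, the height is $$h(G,Y)=\sup\{n\ge 0:\text{ there exist distinct closed invariant subsets } Y_0\subset Y_1\subset\cdots\subset Y_n=Y \text{ of } (G,X)\}\in\{0,1,2,\ldots\}\cup\{+\infty\}.$$ Let $\mathrm{Homeo}(X)$ be the group of all homeomorphisms $X\to X$ (with the discrete topology), and let $$P_h(X)=\{h(G,X) : (G,X)\text{ is a transformation group}\}.$$ A topological graph is a compact connected metrizable space that is a finite union of arcs (subspaces homeomorphic to $[0,1]$, whose end points are the points corresponding to $0$ and $1$), any two distinct ones of which intersect at most in their end points, that is, every common point of two distinct arcs is an end point of both. Theorem. For every topological graph $X$ we have $h(\mathrm{Homeo}(X),X)<+\infty$ and $$P_h(X)=\{h(\mathrm{Homeo}(X),X),\,h(\mathrm{Homeo}(X),X)+1,\,h(\mathrm{Homeo}(X),X)+2,\ldots\}\cup\{+\infty\}.$$ -/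

import Mathlib

universe u v

namespace TransformationGroup

/-- The full homeomorphism group of `X` acts on `X` by evaluation. -/
instance homeoMulAction (X : Type u) [TopologicalSpace X] : MulAction (X ≃ₜ X) X where
  smul f x := f x
  one_smul _ := rfl
  mul_smul _ _ _ := rfl

/-- A closed invariant subset of the transformation group `(G, X)`; invariant sets are nonempty. -/
structure IsClosedInvariant (G : Type v) {X : Type u} [TopologicalSpace X] [Group G]
    [MulAction G X] (Y : Set X) : Prop where
  nonempty : Y.Nonempty
  isClosed : IsClosed Y
  smul_mem : ∀ (g : G), ∀ y ∈ Y, g • y ∈ Y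

/-- The height `h(G, Y)`: the supremum in `ℕ ∪ {+∞}` of all `n` for which there is a chain
`Z 0 ⊂ Z 1 ⊂ ⋯ ⊂ Z n = Y` of distinct closed invariant subsets of `(G, X)`. -/
noncomputable def height (G : Type v) {X : Type u} [TopologicalSpace X] [Group G]
    [MulAction G X] (Y : Set X) : ℕ∞ :=
  sSup {m : ℕ∞ | ∃ (n : ℕ) (Z : Fin (n + 1) → Set X),
    m = n ∧ StrictMono Z ∧ (∀ i, IsClosedInvariant G (Z i)) ∧ Z (Fin.last n) = Y}

/-- The set `P_h(X)` of all heights `h(G, X)` of transformation groups `(G, X)`, where `G` is a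
discrete group acting continuously on `X`. The groups range over the universe of `X`; this is no
restriction, see `height_mem_possibleHeights`. -/
def possibleHeights (X : Type u) [TopologicalSpace X] : Set ℕ∞ :=
  {h | ∃ (G : Type u) (_ : Group G) (_ : TopologicalSpace G) (_ : DiscreteTopology G)
    (_ : MulAction G X) (_ : ContinuousSMul G X), h = height G (Set.univ : Set X)}

theorem height_congr {G : Type v} {H : Type*} {X : Type u} [TopologicalSpace X] [Group G]
    [MulAction G X] [Group H] [MulAction H X]
    (h₁ : ∀ g : G, ∃ k : H, ∀ x : X, k • x = g • x)
    (h₂ : ∀ k : H, ∃ g : G, ∀ x : X, g • x = k • x) (Y : Set X) :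
    height G Y = height H Y := by
  have key : ∀ S : Set X, IsClosedInvariant G S ↔ IsClosedInvariant H S := by
    intro S
    constructor
    · rintro ⟨a, b, c⟩
      refine ⟨a, b, fun k y hy => ?_⟩
      obtain ⟨g, hg⟩ := h₂ k
      exact hg y ▸ c g y hy
    · rintro ⟨a, b, c⟩
      refine ⟨a, b, fun g y hy => ?_⟩
      obtain ⟨k, hk⟩ := h₁ g
      exact hk y ▸ c k y hy
  simp only [height, key]

/-- `P_h(X)` is also the set of heights of subgroups of the homeomorphism group of `X`. -/
theorem mem_possibleHeights_iff {X : Type u} [TopologicalSpace X] {h : ℕ∞} :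
    h ∈ possibleHeights X ↔
      ∃ H : Subgroup (X ≃ₜ X), h = height H (Set.univ : Set X) := by
  constructor
  · rintro ⟨G, _, _, _, _, _, rfl⟩
    let φ : G →* (X ≃ₜ X) :=
      { toFun := fun g => Homeomorph.smul g
        map_one' := by ext x; exact one_smul G x
        map_mul' := fun a b => by ext x; exact mul_smul a b x }
    refine ⟨φ.range, height_congr (fun g => ⟨⟨φ g, g, rfl⟩, fun x => rfl⟩) ?_ _⟩
    rintro ⟨_, g, rfl⟩
    exact ⟨g, fun x => rfl⟩
  · rintro ⟨H, rfl⟩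
    letI : TopologicalSpace H := ⊥
    haveI : DiscreteTopology H := ⟨rfl⟩
    haveI : ContinuousSMul H X :=
      ⟨continuous_prod_of_discrete_left.2 fun f => f.1.continuous⟩
    exact ⟨H, inferInstance, inferInstance, inferInstance, inferInstance, inferInstance, rfl⟩

/-- Transformation groups `(G, X)` with `G` in an arbitrary universe give no further heights. -/
theorem height_mem_possibleHeights (G : Type v) (X : Type u) [TopologicalSpace X] [Group G]
    [TopologicalSpace G] [MulAction G X] [ContinuousSMul G X] :
    height G (Set.univ : Set X) ∈ possibleHeights X := by
  let φ : G →* (X ≃ₜ X) :=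
    { toFun := fun g => Homeomorph.smul g
      map_one' := by ext x; exact one_smul G x
      map_mul' := fun a b => by ext x; exact mul_smul a b x }
  refine mem_possibleHeights_iff.2
    ⟨φ.range, height_congr (fun g => ⟨⟨φ g, g, rfl⟩, fun x => rfl⟩) ?_ _⟩
  rintro ⟨_, g, rfl⟩
  exact ⟨g, fun x => rfl⟩

/-- `A` is an arc in `X` (a subspace homeomorphic to `[0,1]`) with end points `a` and `b`. -/
def IsArc {X : Type u} [TopologicalSpace X] (A : Set X) (a b : X) : Prop :=
  ∃ φ : unitInterval ≃ₜ A, (φ 0 : X) = a ∧ (φ 1 : X) = b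

/-- A topological graph: a compact connected (in particular nonempty) metrizable space that is a
finite union of arcs, any two of which meet at most in their end points. -/
structure IsTopologicalGraph (X : Type u) [TopologicalSpace X] : Prop where
  compactSpace : CompactSpace X
  connectedSpace : ConnectedSpace X
  metrizableSpace : TopologicalSpace.MetrizableSpace X
  exists_arcs : ∃ (n : ℕ) (A : Fin n → Set X) (a b : Fin n → X),
    (∀ i, IsArc (A i) (a i) (b i)) ∧ (⋃ i, A i) = Set.univ ∧
    ∀ i j, i ≠ j → A i ∩ A j ⊆ {a i, b i} ∩ {a j, b j}

end TransformationGroup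

/-!
If `G` has finitely many orbits, each of them open or closed, then the orbit space `X / G` is a
finite `T₀` space. Closed invariant sets correspond to its closed subsets, and peeling off isolated
points one at a time gives `h(G, X) + 1 = #(X / G)`.

For a topological graph decomposed into vertices and open edges, the homeomorphisms preserving the
set of vertices have as orbits finitely many sets of vertices and finitely many unions of edges.
Removing vertices of degree two makes the vertices exactly the points without a neighbourhood like
the line, so that every homeomorphism preserves them. The only exception is the circle, where one
vertex has to be kept and the vertex preserving homeomorphisms have at most two orbits, hence height
at most one.

The height is raised by `k` inside one orbit of edges: parametrize these edges by `ℝ` and split `ℝ`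
into `k + 1` strata such that the increasing bijections preserving the strata act transitively on
each of them, and such that for each `i` the strata of depth at least `i` form an open set. The
homeomorphisms that preserve the depth then have exactly `k` more orbits.
-/

namespace TransformationGroup

open Set Filter Topology

/-! ### Heights and orbit spaces -/

section Height

variable {G : Type*} {X : Type*} [TopologicalSpace X] [Group G] [MulAction G X]

theorem le_height {n : ℕ} {Z : Fin (n + 1) → Set X} (hZ : StrictMono Z)
    (hinv : ∀ i, IsClosedInvariant G (Z i)) : (n : ℕ∞) ≤ height G (Z (Fin.last n)) :=
  le_sSup ⟨n, Z, rfl, hZ, hinv, rfl⟩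

theorem height_le_height {H : Type*} [Group H] [MulAction H X]
    (h : ∀ k : H, ∃ g : G, ∀ x : X, g • x = k • x) (Y : Set X) : height G Y ≤ height H Y := by
  refine sSup_le ?_
  rintro _ ⟨n, Z, rfl, hZ, hinv, rfl⟩
  refine le_height hZ fun i => ⟨(hinv i).1, (hinv i).2, fun k y hy => ?_⟩
  obtain ⟨g, hg⟩ := h k
  exact hg y ▸ (hinv i).3 g y hy

theorem height_add_one_le_of_forall_chain {Y : Set X} (hY : IsClosedInvariant G Y) {c : ℕ∞}
    (h : ∀ (n : ℕ) (Z : Fin (n + 1) → Set X), StrictMono Z → (∀ i, IsClosedInvariant G (Z i)) →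
      Z (Fin.last n) = Y → (n : ℕ∞) + 1 ≤ c) : height G Y + 1 ≤ c := by
  have hne : {m : ℕ∞ | ∃ (n : ℕ) (Z : Fin (n + 1) → Set X), m = n ∧ StrictMono Z ∧
      (∀ i, IsClosedInvariant G (Z i)) ∧ Z (Fin.last n) = Y}.Nonempty :=
    ⟨0, 0, fun _ => Y, rfl, Subsingleton.strictMono (α := Fin 1) _, fun _ => hY, rfl⟩
  rw [height, ENat.sSup_add hne]
  refine iSup₂_le ?_
  rintro _ ⟨n, Z, rfl, hZ, hinv, hlast⟩
  exact h n Z hZ hinv hlast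

theorem height_add_one_le {Y Y' : Set X} (hY : IsClosedInvariant G Y)
    (hY' : IsClosedInvariant G Y') (h : Y ⊂ Y') : height G Y + 1 ≤ height G Y' := by
  refine height_add_one_le_of_forall_chain hY ?_
  rintro n Z hZ hinv rfl
  have hsnoc : StrictMono (Fin.snoc Z Y' : Fin (n + 1 + 1) → Set X) := by
    refine Fin.strictMono_iff_lt_succ.2 fun i => ?_
    induction i using Fin.lastCases with
    | last => simpa using h
    | cast i =>
      simpa only [Fin.succ_castSucc, Fin.snoc_castSucc] using hZ i.castSucc_lt_succ
  have hle := le_height (G := G) hsnoc fun i => by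
    induction i using Fin.lastCases with
    | last => simpa using hY'
    | cast i => simpa using hinv i
  simpa only [Fin.snoc_last, Nat.cast_add_one] using hle

theorem isClosedInvariant_univ [Nonempty X] : IsClosedInvariant G (univ : Set X) :=
  ⟨univ_nonempty, isClosed_univ, fun _ _ _ => mem_univ _⟩

theorem height_eq_top_of_trivial [T1Space X] [Infinite X] (h : ∀ (g : G) (x : X), g • x = x) :
    height G (univ : Set X) = ⊤ := by
  have hfin {S : Set X} (hS : S.Finite) (hne : S.Nonempty) : IsClosedInvariant G S :=
    ⟨hne, hS.isClosed, fun g y hy => (h g y).symm ▸ hy⟩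
  have key (n : ℕ) : ∃ S : Set X, S.Finite ∧ S.Nonempty ∧ (n : ℕ∞) ≤ height G S := by
    induction n with
    | zero => exact ⟨_, finite_singleton (Classical.arbitrary X), singleton_nonempty _, zero_le⟩
    | succ n ih =>
      obtain ⟨S, hS, hne, hn⟩ := ih
      obtain ⟨x, hx⟩ := hS.exists_notMem
      have hS' := hS.insert x
      refine ⟨_, hS', insert_nonempty x S, ?_⟩
      push_cast
      exact (add_le_add_left hn 1).trans
        (height_add_one_le (hfin hS hne) (hfin hS' (insert_nonempty x S)) (ssubset_insert hx))
  refine ENat.eq_top_iff_forall_ge.2 fun n => ?_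
  obtain ⟨S, hS, hne, hn⟩ := key n
  have hSu : S ⊂ univ := ssubset_univ_iff.2 fun h => infinite_univ (h ▸ hS)
  exact hn.trans (le_self_add.trans (height_add_one_le (hfin hS hne) isClosedInvariant_univ hSu))

end Height

section OrbitSpace

variable {G : Type*} {X : Type*} [Group G] [MulAction G X]

theorem mk_eq_mk_iff_mem_orbit {x y : X} :
    (Quotient.mk (MulAction.orbitRel G X) x = Quotient.mk _ y) ↔ x ∈ MulAction.orbit G y :=
  Quotient.eq

theorem preimage_image_mk_of_smul_mem {U : Set X} (hU : ∀ (g : G), ∀ x ∈ U, g • x ∈ U) :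
    Quotient.mk (MulAction.orbitRel G X) ⁻¹' (Quotient.mk _ '' U) = U := by
  refine Subset.antisymm ?_ (subset_preimage_image _ _)
  rintro x ⟨y, hy, hxy⟩
  obtain ⟨g, rfl⟩ := mk_eq_mk_iff_mem_orbit.1 hxy.symm
  exact hU g y hy

variable [TopologicalSpace X]

theorem isClosedInvariant_preimage_mk {S : Set (Quotient (MulAction.orbitRel G X))}
    (hS : IsClosed S) (hne : S.Nonempty) :
    IsClosedInvariant G (Quotient.mk (MulAction.orbitRel G X) ⁻¹' S) where
  nonempty := hne.preimage Quotient.mk_surjective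
  isClosed := hS.preimage isQuotientMap_quotient_mk'.continuous
  smul_mem g y hy := by
    rwa [mem_preimage, mk_eq_mk_iff_mem_orbit.2 (MulAction.mem_orbit y g)]

theorem IsClosedInvariant.ncard_image_mk_lt [Finite (Quotient (MulAction.orbitRel G X))]
    {Y Y' : Set X} (hY : IsClosedInvariant G Y) (hY' : IsClosedInvariant G Y') (h : Y ⊂ Y') :
    (Quotient.mk (MulAction.orbitRel G X) '' Y).ncard <
      (Quotient.mk (MulAction.orbitRel G X) '' Y').ncard := by
  refine ncard_lt_ncard ((image_mono h.subset).ssubset_of_ne fun he => h.ne ?_) (toFinite _)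
  rw [← preimage_image_mk_of_smul_mem hY.smul_mem, he, preimage_image_mk_of_smul_mem hY'.smul_mem]

theorem ncard_le_height_preimage_mk_add_one [Finite (Quotient (MulAction.orbitRel G X))]
    [T0Space (Quotient (MulAction.orbitRel G X))]
    {S : Set (Quotient (MulAction.orbitRel G X))} (hS : IsClosed S) (hne : S.Nonempty) :
    (S.ncard : ℕ∞) ≤ height G (Quotient.mk (MulAction.orbitRel G X) ⁻¹' S) + 1 := by
  induction hn : S.ncard generalizing S with
  | zero => exact zero_le
  | succ n ih =>
    have := hne.to_subtype
    -- a nonempty finite `T₀` space has an isolated point, and removing it lowers the height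
    obtain ⟨⟨q, hq⟩, hopen⟩ := exists_open_singleton_of_finite (X := S)
    obtain ⟨U, hU, hUq⟩ := isOpen_induced_iff.1 hopen
    have hdiff : S \ {q} = S \ U := by
      ext p
      refine and_congr_right fun hp => not_congr ?_
      simpa [Subtype.ext_iff] using (Set.ext_iff.1 hUq ⟨p, hp⟩).symm
    have hclosed : IsClosed (S \ {q}) := hdiff ▸ hS.sdiff hU
    have hcard : (S \ {q}).ncard = n := by rw [ncard_sdiff_singleton_of_mem hq, hn]; rfl
    obtain he | hne' := (S \ {q}).eq_empty_or_nonempty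
    · obtain rfl : n = 0 := by rw [← hcard, he, ncard_empty]
      exact le_add_self
    · push_cast
      refine add_le_add_left ((ih hclosed hne' hcard).trans ?_) 1
      refine height_add_one_le (isClosedInvariant_preimage_mk hclosed hne')
        (isClosedInvariant_preimage_mk hS hne) ?_
      exact (preimage_mono sdiff_subset).ssubset_of_ne fun h =>
        (sdiff_singleton_ssubset.2 hq).ne (Quotient.mk_surjective.preimage_injective h)

theorem height_add_one_eq_card [Nonempty X] [Finite (Quotient (MulAction.orbitRel G X))]
    [T0Space (Quotient (MulAction.orbitRel G X))] :
    height G (univ : Set X) + 1 = Nat.card (Quotient (MulAction.orbitRel G X)) := by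
  refine le_antisymm ?_ ?_
  · refine height_add_one_le_of_forall_chain isClosedInvariant_univ fun n Z hZ hinv _ => ?_
    have hlt (i : Fin (n + 1)) :
        (i : ℕ) + 1 ≤ (Quotient.mk (MulAction.orbitRel G X) '' Z i).ncard := by
      induction i using Fin.induction with
      | zero => exact (ncard_pos (toFinite _)).2 ((hinv 0).nonempty.image _)
      | succ i ih =>
        exact (Nat.succ_le_succ ih).trans
          ((hinv _).ncard_image_mk_lt (hinv _) (hZ i.castSucc_lt_succ))
    exact_mod_cast (hlt (Fin.last n)).trans (ncard_le_card _)
  · have : Nonempty (Quotient (MulAction.orbitRel G X)) := Nonempty.map (Quotient.mk _) ‹_›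
    simpa only [ncard_univ, preimage_univ] using
      ncard_le_height_preimage_mk_add_one (G := G) (X := X) isClosed_univ univ_nonempty

theorem inseparable_mk_iff {x y : X} :
    Inseparable (Quotient.mk (MulAction.orbitRel G X) x) (Quotient.mk _ y) ↔
      ∀ U : Set X, IsOpen U → (∀ (g : G), ∀ z ∈ U, g • z ∈ U) → (x ∈ U ↔ y ∈ U) := by
  have hmk : IsQuotientMap (Quotient.mk (MulAction.orbitRel G X)) := isQuotientMap_quotient_mk'
  rw [inseparable_iff_forall_isOpen]
  constructor
  · intro h U hU hinv
    have hpre := preimage_image_mk_of_smul_mem hinv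
    have hxy := h _ (hmk.isOpen_preimage.1 (hpre.symm ▸ hU))
    rwa [← mem_preimage, ← mem_preimage, hpre] at hxy
  · intro h W hW
    refine h _ (hW.preimage hmk.continuous) fun g z hz => ?_
    rwa [mem_preimage, mk_eq_mk_iff_mem_orbit.2 (MulAction.mem_orbit z g)]

theorem t0Space_orbitQuotient
    (h : ∀ x : X, IsOpen (MulAction.orbit G x) ∨ IsClosed (MulAction.orbit G x)) :
    T0Space (Quotient (MulAction.orbitRel G X)) := by
  refine ⟨fun p q hpq => ?_⟩
  obtain ⟨x, rfl⟩ := Quotient.mk_surjective p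
  obtain ⟨y, rfl⟩ := Quotient.mk_surjective q
  refine (mk_eq_mk_iff_mem_orbit.2 ?_).symm
  have hsmul (g : G) (z : X) (hz : z ∈ MulAction.orbit G x) : g • z ∈ MulAction.orbit G x :=
    MulAction.mem_orbit_of_mem_orbit g hz
  obtain hx | hx := h x
  · exact (inseparable_mk_iff.1 hpq _ hx hsmul).1 (MulAction.mem_orbit_self x)
  · by_contra hy
    refine (inseparable_mk_iff.1 hpq _ hx.isOpen_compl fun g z hz hgz => hz ?_).2 hy
      (MulAction.mem_orbit_self x)
    simpa only [inv_smul_smul] using hsmul g⁻¹ _ hgz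

end OrbitSpace

section OrbitSplit

variable {G K : Type*} {X : Type*} [Group G] [MulAction G X] [Group K] [MulAction K X]
  {o : X} {k : ℕ} {ρ : X → ℕ}

theorem exists_injective_mk_prod_of_orbit_split
    (horb : ∀ x y, x ∈ MulAction.orbit G y ↔ x ∈ MulAction.orbit K y ∧ ρ x = ρ y)
    (hzero : ∀ x ∉ MulAction.orbit K o, ρ x = 0) (himage : ρ '' MulAction.orbit K o = Iic k) :
    ∃ φ : Quotient (MulAction.orbitRel G X) → Quotient (MulAction.orbitRel K X) × ℕ,
      Function.Injective φ ∧
        range φ = range (fun q => (q, 0)) ∪ (fun i => (Quotient.mk _ o, i)) '' Icc 1 k := by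
  refine ⟨fun q => q.lift (fun x => (Quotient.mk _ x, ρ x)) fun x y hxy => ?_, fun p q => ?_, ?_⟩
  · exact Prod.ext (mk_eq_mk_iff_mem_orbit.2 ((horb x y).1 hxy).1) ((horb x y).1 hxy).2
  · induction p, q using Quotient.inductionOn₂ with | h x y =>
    intro hxy
    exact mk_eq_mk_iff_mem_orbit.2 ((horb x y).2
      ⟨mk_eq_mk_iff_mem_orbit.1 (congrArg Prod.fst hxy), congrArg Prod.snd hxy⟩)
  · have hvalue (x : X) (hx : x ∈ MulAction.orbit K o) : ρ x ≤ k :=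
      himage.subset (mem_image_of_mem ρ hx)
    have hattained (i : ℕ) (hi : i ≤ k) : ∃ x ∈ MulAction.orbit K o, ρ x = i :=
      himage.superset hi
    refine Subset.antisymm ?_ (union_subset ?_ ?_)
    · rintro _ ⟨⟨x⟩, rfl⟩
      by_cases h0 : ρ x = 0
      · exact Or.inl ⟨Quotient.mk _ x, Prod.ext rfl h0.symm⟩
      · have hx := not_imp_comm.1 (hzero x) h0
        exact Or.inr ⟨ρ x, ⟨Nat.one_le_iff_ne_zero.2 h0, hvalue x hx⟩,
          Prod.ext (mk_eq_mk_iff_mem_orbit.2 hx).symm rfl⟩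
    · rintro _ ⟨⟨x⟩, rfl⟩
      by_cases hx : x ∈ MulAction.orbit K o
      · obtain ⟨y, hy, hy0⟩ := hattained 0 k.zero_le
        exact ⟨Quotient.mk _ y, Prod.ext (mk_eq_mk_iff_mem_orbit.2
          ((MulAction.orbit_eq_iff.2 hx).symm ▸ hy)) hy0⟩
      · exact ⟨Quotient.mk _ x, Prod.ext rfl (hzero x hx)⟩
    · rintro _ ⟨i, hi, rfl⟩
      obtain ⟨y, hy, rfl⟩ := hattained i hi.2
      exact ⟨Quotient.mk _ y, Prod.ext (mk_eq_mk_iff_mem_orbit.2 hy) rfl⟩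

variable [Finite (Quotient (MulAction.orbitRel K X))]

theorem card_orbitQuotient_of_orbit_split
    (horb : ∀ x y, x ∈ MulAction.orbit G y ↔ x ∈ MulAction.orbit K y ∧ ρ x = ρ y)
    (hzero : ∀ x ∉ MulAction.orbit K o, ρ x = 0) (himage : ρ '' MulAction.orbit K o = Iic k) :
    Finite (Quotient (MulAction.orbitRel G X)) ∧
      Nat.card (Quotient (MulAction.orbitRel G X)) =
        Nat.card (Quotient (MulAction.orbitRel K X)) + k := by
  obtain ⟨φ, hφ, hrange⟩ := exists_injective_mk_prod_of_orbit_split horb hzero himage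
  have : Finite (range φ) :=
    (hrange ▸ (finite_range _).union ((finite_Icc 1 k).image _) : (range φ).Finite)
  refine ⟨Finite.of_injective_finite_range hφ, ?_⟩
  have hdisj : Disjoint (range fun q : Quotient (MulAction.orbitRel K X) => (q, 0))
      ((fun i => (Quotient.mk _ o, i)) '' Icc 1 k) := by
    refine disjoint_left.2 ?_
    rintro _ ⟨q, rfl⟩ ⟨i, hi, h⟩
    exact Nat.one_le_iff_ne_zero.1 hi.1 (congrArg Prod.snd h)
  rw [← Nat.card_range_of_injective hφ, Nat.card_coe_set_eq, hrange,
    ncard_union_eq hdisj (finite_range _) ((finite_Icc 1 k).image _),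
    ncard_image_of_injective _ (Prod.mk_right_injective _), ← Nat.card_coe_set_eq,
    Nat.card_range_of_injective (Prod.mk_left_injective 0)]
  simp

theorem height_eq_add_of_orbit_split [TopologicalSpace X]
    [T0Space (Quotient (MulAction.orbitRel K X))]
    (horb : ∀ x y, x ∈ MulAction.orbit G y ↔ x ∈ MulAction.orbit K y ∧ ρ x = ρ y)
    (hρ : LowerSemicontinuous ρ) (hzero : ∀ x ∉ MulAction.orbit K o, ρ x = 0)
    (himage : ρ '' MulAction.orbit K o = Iic k) :
    height G (univ : Set X) = height K (univ : Set X) + k := by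
  obtain ⟨hfin, hcard⟩ := card_orbitQuotient_of_orbit_split horb hzero himage
  have hT0 : T0Space (Quotient (MulAction.orbitRel G X)) := by
    refine ⟨fun p q => ?_⟩
    induction p, q using Quotient.inductionOn₂ with | h x y =>
    intro hxy
    have hinsep := inseparable_mk_iff.1 hxy
    have hsmul (g : G) (z : X) := (horb (g • z) z).1 (MulAction.mem_orbit z g)
    have hle {j : ℕ} : j < ρ x ↔ j < ρ y :=
      hinsep _ (hρ.isOpen_preimage j) fun g z hz => by rwa [mem_preimage, (hsmul g z).2]
    have hK : Inseparable (Quotient.mk (MulAction.orbitRel K X) x) (Quotient.mk _ y) := by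
      refine inseparable_mk_iff.2 fun U hU hinv => hinsep U hU fun g z hz => ?_
      obtain ⟨a, ha⟩ := (hsmul g z).1
      exact ha ▸ hinv a z hz
    exact mk_eq_mk_iff_mem_orbit.2 ((horb x y).2
      ⟨mk_eq_mk_iff_mem_orbit.1 hK.eq, eq_of_forall_lt_iff fun _ => hle⟩)
  have : Nonempty X := ⟨o⟩
  refine ENat.add_left_injective_of_ne_top ENat.one_ne_top ?_
  simp only
  rw [height_add_one_eq_card, hcard, add_right_comm, height_add_one_eq_card, Nat.cast_add]

end OrbitSplit

/-! ### A self-similar stratification of the line -/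

section ViaEmbedding

variable {α β : Type*} [LinearOrder α] [LinearOrder β] (σ : α ↪o β)

theorem strictMono_of_eq_on_range {f : β → β} (hσ : (range σ).OrdConnected) (c : α ≃o α)
    (hin : ∀ a, f (σ a) = σ (c a)) (hout : ∀ x ∉ range σ, f x = x) : StrictMono f := by
  intro x y hxy
  by_cases hx : x ∈ range σ <;> by_cases hy : y ∈ range σ
  · obtain ⟨a, rfl⟩ := hx
    obtain ⟨b, rfl⟩ := hy
    simpa only [hin, σ.lt_iff_lt, c.lt_iff_lt] using hxy
  · obtain ⟨a, rfl⟩ := hx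
    rw [hin, hout _ hy]
    exact lt_of_not_ge fun h => hy (hσ.out ⟨a, rfl⟩ ⟨c a, rfl⟩ ⟨hxy.le, h⟩)
  · obtain ⟨b, rfl⟩ := hy
    rw [hin, hout _ hx]
    exact lt_of_not_ge fun h => hx (hσ.out ⟨c b, rfl⟩ ⟨b, rfl⟩ ⟨h, hxy.le⟩)
  · rwa [hout _ hx, hout _ hy]

theorem exists_orderIso_extending (hσ : (range σ).OrdConnected) (c : α ≃o α) :
    ∃ d : β ≃o β, (∀ a, d (σ a) = σ (c a)) ∧ ∀ x ∉ range σ, d x = x := by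
  have hin := Equiv.Perm.viaEmbedding_apply c.toEquiv σ.toEmbedding
  have hout := Equiv.Perm.viaEmbedding_apply_of_notMem c.toEquiv σ.toEmbedding
  exact ⟨(strictMono_of_eq_on_range σ hσ c hin hout).orderIsoOfSurjective _ (Equiv.surjective _),
    hin, hout⟩

end ViaEmbedding

theorem isOpenEmbedding_sigmoid : IsOpenEmbedding Real.sigmoid where
  toIsEmbedding := Real.sigmoid_strictMono.isEmbedding_of_ordConnected
    (by rw [Real.range_sigmoid]; exact ordConnected_Ioo)
  isOpen_range := by rw [Real.range_sigmoid]; exact isOpen_Ioo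

/-- A function on the line with values in `{0, …, k}` whose automorphisms act transitively on each
of its level sets. For `k > 0` it vanishes on `ℤ`, and on each open unit interval between
consecutive integers, identified with `ℝ` by the sigmoid function, it is one more than the function
for `k - 1`. -/
noncomputable def latticeDepth : ℕ → ℝ → ℕ
  | 0, _ => 0
  | k + 1, x => Function.extend Real.sigmoid (fun y => latticeDepth k y + 1) 0 (Int.fract x)

theorem latticeDepth_add_intCast (k : ℕ) (x : ℝ) (n : ℤ) :
    latticeDepth k (x + n) = latticeDepth k x := by
  cases k with
  | zero => rfl
  | succ k => simp only [latticeDepth, Int.fract_add_intCast]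

theorem latticeDepth_intCast (k : ℕ) (n : ℤ) : latticeDepth k n = 0 := by
  cases k with
  | zero => rfl
  | succ k =>
    have h0 : ¬ ∃ y, Real.sigmoid y = 0 := fun ⟨y, hy⟩ => (Real.sigmoid_pos y).ne' hy
    simp only [latticeDepth, Int.fract_intCast, Function.extend_apply' _ _ _ h0, Pi.zero_apply]

theorem latticeDepth_succ_sigmoid (k : ℕ) (y : ℝ) :
    latticeDepth (k + 1) (Real.sigmoid y) = latticeDepth k y + 1 := by
  rw [latticeDepth, Int.fract_eq_self.2 ⟨Real.sigmoid_nonneg y, Real.sigmoid_lt_one y⟩,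
    Real.sigmoid_injective.extend_apply]

theorem latticeDepth_succ_sigmoid_add (k : ℕ) (y : ℝ) (n : ℤ) :
    latticeDepth (k + 1) (Real.sigmoid y + n) = latticeDepth k y + 1 := by
  rw [latticeDepth_add_intCast, latticeDepth_succ_sigmoid]

theorem eq_intCast_or_eq_sigmoid_add (x : ℝ) :
    (∃ n : ℤ, x = n) ∨ ∃ (y : ℝ) (n : ℤ), x = Real.sigmoid y + n := by
  obtain h0 | hpos := (Int.fract_nonneg x).eq_or_lt
  · exact Or.inl ⟨⌊x⌋, by rw [← Int.fract_add_floor x, ← h0, zero_add, Int.floor_intCast]⟩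
  · obtain ⟨y, hy⟩ := Real.range_sigmoid.superset (mem_Ioo.2 ⟨hpos, Int.fract_lt_one x⟩)
    exact Or.inr ⟨y, ⌊x⌋, by rw [hy, Int.fract_add_floor]⟩

theorem range_latticeDepth (k : ℕ) : range (latticeDepth k) = Iic k := by
  induction k with
  | zero => exact range_const.trans (Iic_bot (α := ℕ)).symm
  | succ k ih =>
    refine Subset.antisymm ?_ fun i hi => ?_
    · rintro _ ⟨x, rfl⟩
      obtain ⟨n, rfl⟩ | ⟨y, n, rfl⟩ := eq_intCast_or_eq_sigmoid_add x
      · exact (latticeDepth_intCast _ n).trans_le (Nat.zero_le _)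
      · exact (latticeDepth_succ_sigmoid_add k y n).trans_le
          (Nat.succ_le_succ (ih.subset (mem_range_self y)))
    · cases i with
      | zero => exact ⟨_, latticeDepth_intCast (k + 1) 0⟩
      | succ i =>
        obtain ⟨y, rfl⟩ := ih.superset (Nat.le_of_succ_le_succ hi)
        exact ⟨_, latticeDepth_succ_sigmoid k y⟩

theorem latticeDepth_neg (k : ℕ) (x : ℝ) : latticeDepth k (-x) = latticeDepth k x := by
  induction k generalizing x with
  | zero => rfl
  | succ k ih =>
    obtain ⟨n, rfl⟩ | ⟨y, n, rfl⟩ := eq_intCast_or_eq_sigmoid_add x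
    · rw [← Int.cast_neg, latticeDepth_intCast, latticeDepth_intCast]
    · have hneg : -(Real.sigmoid y + n) = Real.sigmoid (-y) + (-(n + 1) : ℤ) := by
        rw [Real.sigmoid_neg]
        push_cast
        ring
      rw [hneg, latticeDepth_succ_sigmoid_add, ih, latticeDepth_succ_sigmoid_add]

theorem lowerSemicontinuous_latticeDepth (k : ℕ) : LowerSemicontinuous (latticeDepth k) := by
  induction k with
  | zero => exact lowerSemicontinuous_const
  | succ k ih =>
    intro x j hj
    obtain ⟨n, rfl⟩ | ⟨y, n, rfl⟩ := eq_intCast_or_eq_sigmoid_add x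
    · exact absurd hj (latticeDepth_intCast (k + 1) n ▸ Nat.not_lt_zero j)
    · have hopen : IsOpenEmbedding fun y => Real.sigmoid y + n :=
        (Homeomorph.addRight (n : ℝ)).isOpenEmbedding.comp isOpenEmbedding_sigmoid
      rw [latticeDepth_succ_sigmoid_add] at hj
      simpa only [← hopen.map_nhds_eq y, eventually_map, latticeDepth_succ_sigmoid_add] using
        ((ih.add lowerSemicontinuous_const) y j hj :)

theorem exists_orderIso_sigmoid_extending (c : ℝ ≃o ℝ) {k : ℕ}
    (hc : ∀ t, latticeDepth k (c t) = latticeDepth k t) :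
    ∃ d : ℝ ≃o ℝ, (∀ t, latticeDepth (k + 1) (d t) = latticeDepth (k + 1) t) ∧
      ∀ t, d (Real.sigmoid t) = Real.sigmoid (c t) := by
  have hord : (range (OrderEmbedding.ofStrictMono _ Real.sigmoid_strictMono)).OrdConnected := by
    rw [OrderEmbedding.coe_ofStrictMono, Real.range_sigmoid]
    exact ordConnected_Ioo
  obtain ⟨d, hin, hout⟩ := exists_orderIso_extending _ hord c
  refine ⟨d, fun t => ?_, hin⟩
  by_cases ht : t ∈ range Real.sigmoid
  · obtain ⟨s, rfl⟩ := ht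
    refine (congrArg _ (hin s)).trans ?_
    rw [OrderEmbedding.coe_ofStrictMono, latticeDepth_succ_sigmoid, hc, latticeDepth_succ_sigmoid]
  · rw [hout t ht]

theorem exists_orderIso_latticeDepth {k : ℕ} {x y : ℝ} (h : latticeDepth k x = latticeDepth k y) :
    ∃ c : ℝ ≃o ℝ, (∀ t, latticeDepth k (c t) = latticeDepth k t) ∧ c x = y := by
  induction k generalizing x y with
  | zero => exact ⟨OrderIso.addRight (y - x), fun _ => rfl, add_sub_cancel x y⟩
  | succ k ih =>
    obtain ⟨m, rfl⟩ | ⟨x, m, rfl⟩ := eq_intCast_or_eq_sigmoid_add x <;>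
      obtain ⟨n, rfl⟩ | ⟨y, n, rfl⟩ := eq_intCast_or_eq_sigmoid_add y <;>
      simp only [latticeDepth_intCast, latticeDepth_succ_sigmoid_add] at h
    · refine ⟨OrderIso.addRight ((n - m : ℤ) : ℝ), fun t => latticeDepth_add_intCast _ t _, ?_⟩
      simp
    · omega
    · omega
    · obtain ⟨c, hc, rfl⟩ := ih (Nat.succ_injective h)
      obtain ⟨d, hd, hdc⟩ := exists_orderIso_sigmoid_extending c hc
      refine ⟨(OrderIso.addRight ((-m : ℤ) : ℝ)).trans (d.trans (OrderIso.addRight (n : ℝ))),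
        fun t => ?_, ?_⟩
      · simp only [OrderIso.trans_apply, OrderIso.addRight_apply, latticeDepth_add_intCast, hd]
      · simp [hdc]

/-! ### Decompositions into vertices and open edges -/

/-- A decomposition of a space into finitely many vertices and finitely many open edges, each edge
parametrized by the line and converging to a vertex at both ends. The end of the edge `e` at `+∞` is
the half-edge `(e, 1)`, the end at `-∞` is the half-edge `(e, -1)`. Loops and multiple edges are
allowed. -/
structure GraphDecomposition (X : Type*) [TopologicalSpace X] where
  vertices : Set X
  Edge : Type
  param : Edge → ℝ → X
  endpoint : Edge × ℤˣ → X
  finite_vertices : vertices.Finite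
  finite_edge : Finite Edge
  continuous_param (e : Edge) : Continuous (param e)
  injective_param : Function.Injective (Function.uncurry param)
  range_param : range (Function.uncurry param) = verticesᶜ
  endpoint_mem (h : Edge × ℤˣ) : endpoint h ∈ vertices
  tendsto_param (h : Edge × ℤˣ) :
    Tendsto (fun t : ℝ => param h.1 (h.2 • t)) atTop (𝓝 (endpoint h))

theorem ultrafilter_le_cocompact_or_le_nhds {Y : Type*} [TopologicalSpace Y] (W : Ultrafilter Y) :
    (W : Filter Y) ≤ cocompact Y ∨ ∃ y, (W : Filter Y) ≤ 𝓝 y := by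
  by_cases h : ∃ K ∈ W, IsCompact K
  · obtain ⟨K, hKW, hK⟩ := h
    obtain ⟨y, -, hy⟩ := hK.ultrafilter_le_nhds' W hKW
    exact Or.inr ⟨y, hy⟩
  · push Not at h
    exact Or.inl ((hasBasis_cocompact.ge_iff).2 fun K hK =>
      Ultrafilter.compl_mem_iff_notMem.2 fun hKW => h K hKW hK)

namespace GraphDecomposition

variable {X : Type*} [TopologicalSpace X] (D : GraphDecomposition X)

/-- The edge of a half-edge, parametrized so that its end at `+∞` is the given one. -/
def ray (h : D.Edge × ℤˣ) (t : ℝ) : X :=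
  D.param h.1 (h.2 • t)

theorem continuous_ray (h : D.Edge × ℤˣ) : Continuous (D.ray h) :=
  (D.continuous_param h.1).comp (continuous_const_smul h.2)

theorem tendsto_ray (h : D.Edge × ℤˣ) : Tendsto (D.ray h) atTop (𝓝 (D.endpoint h)) :=
  D.tendsto_param h

theorem param_inj {e e' : D.Edge} {t t' : ℝ} : D.param e t = D.param e' t' ↔ e = e' ∧ t = t' :=
  (D.injective_param.eq_iff (a := (e, t)) (b := (e', t'))).trans Prod.mk_inj

theorem injective_param_edge (e : D.Edge) : Function.Injective (D.param e) :=
  fun _ _ h => (D.param_inj.1 h).2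

theorem param_notMem_vertices (e : D.Edge) (t : ℝ) : D.param e t ∉ D.vertices :=
  D.range_param.subset ⟨(e, t), rfl⟩

theorem mem_vertices_or_exists_param (x : X) : x ∈ D.vertices ∨ ∃ e t, D.param e t = x :=
  or_iff_not_imp_left.2 fun hx => Prod.exists.1 (D.range_param.superset hx)

theorem endpoint_ne_param (h : D.Edge × ℤˣ) (e : D.Edge) (t : ℝ) : D.endpoint h ≠ D.param e t :=
  fun he => D.param_notMem_vertices e t (he ▸ D.endpoint_mem h)

theorem exists_map_le_ray_of_le_cocompact (e : D.Edge) {W : Ultrafilter ℝ}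
    (hW : (W : Filter ℝ) ≤ cocompact ℝ) :
    ∃ s : ℤˣ, (W.map (D.param e) : Filter X) ≤ map (D.ray (e, s)) atTop := by
  rw [cocompact_eq_atBot_atTop, Ultrafilter.le_sup_iff] at hW
  obtain hW | hW := hW
  · refine ⟨-1, (map_mono hW).trans ?_⟩
    rw [← map_neg_atTop, map_map]
    exact le_of_eq (congrArg (map · atTop) (funext fun t => by simp [ray]))
  · refine ⟨1, (map_mono hW).trans (le_of_eq (congrArg (map · atTop) (funext fun t => ?_)))⟩
    simp [ray]

section Glue

variable {Y : Type*}

/-- The map equal to `a` at the vertices and given by `F` in the parameters of the edges. -/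
noncomputable def glue (a : X → Y) (F : D.Edge → ℝ → Y) : X → Y :=
  Function.extend (Function.uncurry D.param) (Function.uncurry F) a

variable (a : X → Y) (F : D.Edge → ℝ → Y)

@[simp]
theorem glue_param (e : D.Edge) (t : ℝ) : D.glue a F (D.param e t) = F e t :=
  D.injective_param.extend_apply (Function.uncurry F) a (e, t)

theorem glue_of_mem_vertices {x : X} (hx : x ∈ D.vertices) : D.glue a F x = a x :=
  Function.extend_apply' _ _ _ fun h => (D.range_param.subset h) hx

end Glue

variable [T2Space X]

theorem nhds_le (x : X) :
    𝓝 x ≤ pure x ⊔ (⨆ h : {h // D.endpoint h = x}, map (D.ray h) atTop) ⊔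
      ⨆ p : {p : D.Edge × ℝ // D.param p.1 p.2 = x}, map (D.param p.1.1) (𝓝 p.1.2) := by
  refine le_iff_ultrafilter.2 fun U hU => ?_
  have := D.finite_edge
  have hcover : D.vertices ∪ ⋃ e ∈ univ, range (D.param e) ∈ U :=
    univ_mem' (f := (U : Filter X)) fun y => (D.mem_vertices_or_exists_param y).imp_right
      fun ⟨e, t, ht⟩ => mem_biUnion (mem_univ e) ⟨t, ht⟩
  rw [Ultrafilter.union_mem_iff, Ultrafilter.finite_biUnion_mem_iff finite_univ] at hcover
  obtain hV | ⟨e, -, he⟩ := hcover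
  · obtain ⟨v, -, rfl⟩ := U.eq_pure_of_finite_mem D.finite_vertices hV
    rw [pure_le_nhds_iff.1 hU]
    exact le_sup_of_le_left le_sup_left
  · obtain ⟨W, rfl⟩ : ∃ W : Ultrafilter ℝ, W.map (D.param e) = U :=
      ⟨U.comap (D.injective_param_edge e) he, Ultrafilter.coe_injective (map_comap_of_mem he)⟩
    obtain hW | ⟨t, hW⟩ := ultrafilter_le_cocompact_or_le_nhds W
    · obtain ⟨s, hs⟩ := D.exists_map_le_ray_of_le_cocompact e hW
      have hx : D.endpoint (e, s) = x :=
        tendsto_nhds_unique' (W.map (D.param e)).neBot (hs.trans (D.tendsto_ray _)) hU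
      exact hs.trans (le_sup_of_le_left (le_sup_of_le_right
        (le_iSup (fun h : {h // D.endpoint h = x} => map (D.ray h) atTop) ⟨(e, s), hx⟩)))
    · have hx : D.param e t = x := tendsto_nhds_unique' (W.map (D.param e)).neBot
        ((map_mono hW).trans (D.continuous_param e).continuousAt) hU
      exact (map_mono hW).trans (le_sup_of_le_right (le_iSup
        (fun p : {p : D.Edge × ℝ // D.param p.1 p.2 = x} => map (D.param p.1.1) (𝓝 p.1.2))
        ⟨(e, t), hx⟩))

theorem nhds_param (e : D.Edge) (t : ℝ) : 𝓝 (D.param e t) = map (D.param e) (𝓝 t) := by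
  refine le_antisymm ((D.nhds_le _).trans (sup_le (sup_le ?_ ?_) ?_))
    (D.continuous_param e).continuousAt
  · exact (map_pure _ t).ge.trans (map_mono (pure_le_nhds t))
  · exact iSup_le fun ⟨h, hh⟩ => absurd hh (D.endpoint_ne_param h e t)
  · refine iSup_le ?_
    rintro ⟨⟨e', t'⟩, h⟩
    obtain ⟨rfl, rfl⟩ := D.param_inj.1 h
    exact le_rfl

theorem isOpenEmbedding_param (e : D.Edge) : IsOpenEmbedding (D.param e) :=
  .of_continuous_injective_isOpenMap (D.continuous_param e) (D.injective_param_edge e)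
    (IsOpenMap.of_nhds_le fun t => (D.nhds_param e t).le)

theorem continuous_of_param {Y : Type*} [TopologicalSpace Y] {f : X → Y}
    (hparam : ∀ e, Continuous (f ∘ D.param e))
    (hray : ∀ h, Tendsto (f ∘ D.ray h) atTop (𝓝 (f (D.endpoint h)))) : Continuous f := by
  refine continuous_iff_continuousAt.2 fun x => Tendsto.mono_left ?_ (D.nhds_le x)
  refine ((tendsto_pure_nhds f x).sup (tendsto_iSup.2 ?_)).sup (tendsto_iSup.2 ?_)
  · rintro ⟨h, rfl⟩
    exact hray h
  · rintro ⟨⟨e, t⟩, rfl⟩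
    exact (hparam e).continuousAt

theorem continuous_glue_param (c : D.Edge → ℝ ≃o ℝ) :
    Continuous (D.glue id fun e t => D.param e (c e t)) := by
  refine D.continuous_of_param (fun e => ?_) fun h => ?_
  · simpa only [Function.comp_def, glue_param] using (D.continuous_param e).comp (c e).continuous
  · rw [D.glue_of_mem_vertices _ _ (D.endpoint_mem h), id]
    have hc : Tendsto (fun t : ℝ => h.2 • c h.1 (h.2 • t)) atTop atTop := by
      obtain hs | hs := Int.units_eq_one_or h.2 <;>
        simp only [hs, one_smul, Units.neg_smul]
      · exact (c h.1).tendsto_atTop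
      · exact tendsto_neg_atBot_atTop.comp ((c h.1).tendsto_atBot.comp tendsto_neg_atTop_atBot)
    refine ((D.tendsto_ray h).comp hc).congr fun t => ?_
    simp only [Function.comp_apply, ray, glue_param, smul_smul, Int.units_mul_self, one_smul]

/-- The homeomorphism fixing the vertices and acting on the parameter of each edge `e` by `c e`. -/
noncomputable def edgeHomeomorph (c : D.Edge → ℝ ≃o ℝ) : X ≃ₜ X where
  toFun := D.glue id fun e t => D.param e (c e t)
  invFun := D.glue id fun e t => D.param e ((c e).symm t)
  left_inv x := by
    obtain hx | ⟨e, t, rfl⟩ := D.mem_vertices_or_exists_param x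
    · simp only [D.glue_of_mem_vertices _ _ hx, id]
    · simp only [glue_param, OrderIso.symm_apply_apply]
  right_inv x := by
    obtain hx | ⟨e, t, rfl⟩ := D.mem_vertices_or_exists_param x
    · simp only [D.glue_of_mem_vertices _ _ hx, id]
    · simp only [glue_param, OrderIso.apply_symm_apply]
  continuous_toFun := D.continuous_glue_param c
  continuous_invFun := D.continuous_glue_param fun e => (c e).symm

theorem edgeHomeomorph_param (c : D.Edge → ℝ ≃o ℝ) (e : D.Edge) (t : ℝ) :
    D.edgeHomeomorph c (D.param e t) = D.param e (c e t) :=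
  D.glue_param _ _ e t

theorem edgeHomeomorph_of_mem_vertices (c : D.Edge → ℝ ≃o ℝ) {v : X} (hv : v ∈ D.vertices) :
    D.edgeHomeomorph c v = v :=
  D.glue_of_mem_vertices _ _ hv

end GraphDecomposition

/-! ### Homeomorphisms preserving the vertices -/

theorem exists_subset_of_isPreconnected {ι X : Type*} [TopologicalSpace X] {U : ι → Set X}
    (hU : ∀ i, IsOpen (U i)) (hdisj : Pairwise (Function.onFun Disjoint U)) {C : Set X}
    (hC : IsPreconnected C) (hne : C.Nonempty) (hCU : C ⊆ ⋃ i, U i) : ∃ i, C ⊆ U i := by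
  obtain ⟨x, hx⟩ := hne
  obtain ⟨i, hi⟩ := mem_iUnion.1 (hCU hx)
  refine ⟨i, hC.subset_left_of_subset_union (hU i)
    (isOpen_biUnion fun j (_ : j ≠ i) => hU j)
    (disjoint_iUnion₂_right.2 fun _ hj => hdisj (Ne.symm hj)) (fun y hy => ?_) ⟨x, hx, hi⟩⟩
  obtain ⟨j, hj⟩ := mem_iUnion.1 (hCU hy)
  obtain rfl | hji := eq_or_ne j i
  · exact Or.inl hj
  · exact Or.inr (mem_biUnion hji hj)

theorem exists_orderIso_of_range_eq {X : Type*} [TopologicalSpace X] {φ ψ : ℝ → X}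
    (hφ : IsEmbedding φ) (hψ : IsEmbedding ψ) (h : range φ = range ψ) :
    ∃ (c : ℝ ≃o ℝ) (u : ℤˣ), ∀ t, φ (c t) = ψ (u • t) := by
  let k : ℝ ≃ₜ ℝ :=
    (hψ.toHomeomorph.trans (Homeomorph.setCongr h.symm)).trans hφ.toHomeomorph.symm
  have hk (t : ℝ) : φ (k t) = ψ t :=
    congrArg Subtype.val (hφ.toHomeomorph.apply_symm_apply ⟨ψ t, _⟩)
  obtain hmono | hanti := k.continuous.strictMono_of_inj k.injective
  · exact ⟨hmono.orderIsoOfSurjective k k.surjective, 1, fun t => by simp [hk]⟩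
  · exact ⟨(hanti.comp fun _ _ => neg_lt_neg).orderIsoOfSurjective (k ∘ Neg.neg)
      (k.surjective.comp neg_surjective), -1, fun t => by simp [hk]⟩

section Preserving

variable {X α : Type*} [TopologicalSpace X]

/-- The group of all homeomorphisms under which the function `ρ` is invariant. -/
def preserving (ρ : X → α) : Subgroup (X ≃ₜ X) where
  carrier := {f | ∀ x, ρ (f x) = ρ x}
  mul_mem' hf hg x := (hf _).trans (hg x)
  one_mem' _ := rfl
  inv_mem' {f} hf x := (hf (f⁻¹ x)).symm.trans (congrArg ρ (f.apply_symm_apply x))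

theorem mem_orbit_subgroup_iff {H : Subgroup (X ≃ₜ X)} {x y : X} :
    x ∈ MulAction.orbit H y ↔ ∃ f ∈ H, f y = x :=
  ⟨fun ⟨f, hf⟩ => ⟨f, f.2, hf⟩, fun ⟨f, hfH, hf⟩ => ⟨⟨f, hfH⟩, hf⟩⟩

end Preserving

namespace GraphDecomposition

variable {X : Type*} [TopologicalSpace X] (D : GraphDecomposition X)

/-- The group of all homeomorphisms mapping vertices to vertices and edge points to edge points. -/
abbrev vertexPreserving : Subgroup (X ≃ₜ X) :=
  preserving (· ∈ D.vertices)

variable {D}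

theorem mem_vertices_iff_of_mem {f : X ≃ₜ X} (hf : f ∈ D.vertexPreserving) (x : X) :
    f x ∈ D.vertices ↔ x ∈ D.vertices :=
  iff_of_eq (hf x)

variable (D)

theorem pairwise_disjoint_range_param :
    Pairwise (Function.onFun Disjoint fun e => range (D.param e)) := by
  refine fun e e' hne => disjoint_left.2 ?_
  rintro _ ⟨t, rfl⟩ ⟨t', h⟩
  exact hne (D.param_inj.1 h).1.symm

variable [T2Space X]

theorem exists_subset_range_param {C : Set X} (hC : IsPreconnected C) (hne : C.Nonempty)
    (hCV : Disjoint C D.vertices) : ∃ e, C ⊆ range (D.param e) :=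
  exists_subset_of_isPreconnected (fun e => (D.isOpenEmbedding_param e).isOpen_range)
    D.pairwise_disjoint_range_param hC hne fun x hx => mem_iUnion.2
      ((D.mem_vertices_or_exists_param x).resolve_left (disjoint_left.1 hCV hx))

variable {D}

theorem exists_range_comp_param_subset {f : X ≃ₜ X} (hf : f ∈ D.vertexPreserving) (e : D.Edge) :
    ∃ e', range (f ∘ D.param e) ⊆ range (D.param e') := by
  refine D.exists_subset_range_param (isPreconnected_range (f.continuous.comp
    (D.continuous_param e))) (range_nonempty _) (disjoint_left.2 ?_)
  rintro _ ⟨t, rfl⟩ ht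
  exact D.param_notMem_vertices e t ((mem_vertices_iff_of_mem hf _).1 ht)

theorem exists_range_comp_param_eq {f : X ≃ₜ X} (hf : f ∈ D.vertexPreserving) (e : D.Edge) :
    ∃ e', range (f ∘ D.param e) = range (D.param e') := by
  obtain ⟨e', he'⟩ := exists_range_comp_param_subset hf e
  obtain ⟨e'', he''⟩ := exists_range_comp_param_subset (inv_mem hf) e'
  have hback {t t' : ℝ} (h : D.param e' t = f (D.param e t')) : e'' = e := by
    obtain ⟨s, hs⟩ := he'' ⟨t, rfl⟩
    exact (D.param_inj.1 (hs.trans (f.symm_apply_eq.2 h))).1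
  refine ⟨e', he'.antisymm ?_⟩
  obtain ⟨t₀, ht₀⟩ := he' ⟨0, rfl⟩
  obtain rfl := hback ht₀
  rintro _ ⟨t, rfl⟩
  obtain ⟨s, hs⟩ := he'' ⟨t, rfl⟩
  exact ⟨s, f.symm_apply_eq.1 hs.symm |>.symm⟩

theorem exists_orderIso_straightening {f : X ≃ₜ X} (hf : f ∈ D.vertexPreserving) :
    ∃ c : D.Edge → ℝ ≃o ℝ, ∀ e, ∃ (e' : D.Edge) (u : ℤˣ),
      ∀ t, f (D.param e (c e t)) = D.param e' (u • t) := by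
  choose e' he' using exists_range_comp_param_eq hf
  choose c u h using fun e => exists_orderIso_of_range_eq
    (f.isEmbedding.comp (D.isOpenEmbedding_param e).isEmbedding)
    (D.isOpenEmbedding_param (e' e)).isEmbedding (he' e)
  exact ⟨c, fun e => ⟨e' e, u e, h e⟩⟩

variable (D)

theorem edgeHomeomorph_mem_preserving {α : Type*} {ρ : X → α} {c : D.Edge → ℝ ≃o ℝ}
    (hc : ∀ e t, ρ (D.param e (c e t)) = ρ (D.param e t)) :
    D.edgeHomeomorph c ∈ preserving ρ := by
  intro x
  obtain hx | ⟨e, t, rfl⟩ := D.mem_vertices_or_exists_param x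
  · rw [D.edgeHomeomorph_of_mem_vertices c hx]
  · rw [D.edgeHomeomorph_param, hc]

theorem edgeHomeomorph_mem_vertexPreserving (c : D.Edge → ℝ ≃o ℝ) :
    D.edgeHomeomorph c ∈ D.vertexPreserving :=
  D.edgeHomeomorph_mem_preserving fun _ _ => propext
    (iff_of_false (D.param_notMem_vertices _ _) (D.param_notMem_vertices _ _))

theorem param_mem_orbit (e : D.Edge) (s t : ℝ) :
    D.param e s ∈ MulAction.orbit D.vertexPreserving (D.param e t) := by
  refine mem_orbit_subgroup_iff.2 ⟨D.edgeHomeomorph fun _ => OrderIso.addRight (s - t),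
    D.edgeHomeomorph_mem_vertexPreserving _, ?_⟩
  rw [edgeHomeomorph_param, OrderIso.addRight_apply, add_sub_cancel]

theorem isOpen_or_isClosed_orbit (x : X) :
    IsOpen (MulAction.orbit D.vertexPreserving x) ∨
      IsClosed (MulAction.orbit D.vertexPreserving x) := by
  have hiff {y : X} (hy : y ∈ MulAction.orbit D.vertexPreserving x) :
      y ∈ D.vertices ↔ x ∈ D.vertices := by
    obtain ⟨f, hf, rfl⟩ := mem_orbit_subgroup_iff.1 hy
    exact mem_vertices_iff_of_mem hf x
  by_cases hx : x ∈ D.vertices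
  · exact Or.inr (D.finite_vertices.subset fun y hy => (hiff hy).2 hx).isClosed
  · refine Or.inl (isOpen_iff_mem_nhds.2 fun y hy => ?_)
    obtain ⟨e, t, rfl⟩ := (D.mem_vertices_or_exists_param y).resolve_left (mt (hiff hy).1 hx)
    filter_upwards [(D.isOpenEmbedding_param e).isOpen_range.mem_nhds ⟨t, rfl⟩]
    rintro _ ⟨s, rfl⟩
    exact MulAction.orbit_eq_iff.2 hy ▸ D.param_mem_orbit e s t

instance : T0Space (Quotient (MulAction.orbitRel D.vertexPreserving X)) :=
  t0Space_orbitQuotient D.isOpen_or_isClosed_orbit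

theorem range_mk_vertexPreserving :
    range (Quotient.mk (MulAction.orbitRel D.vertexPreserving X)) =
      Quotient.mk _ '' D.vertices ∪ range fun e => Quotient.mk _ (D.param e 0) := by
  refine Subset.antisymm ?_ (union_subset (image_subset_range _ _) (range_subset_iff.2 fun _ =>
    mem_range_self _))
  rintro _ ⟨x, rfl⟩
  obtain hx | ⟨e, t, rfl⟩ := D.mem_vertices_or_exists_param x
  · exact Or.inl (mem_image_of_mem _ hx)
  · exact Or.inr ⟨e, mk_eq_mk_iff_mem_orbit.2 (D.param_mem_orbit e 0 t)⟩

instance : Finite (Quotient (MulAction.orbitRel D.vertexPreserving X)) := by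
  have := D.finite_edge
  rw [← finite_univ_iff, ← Quotient.mk_surjective.range_eq, D.range_mk_vertexPreserving]
  exact (D.finite_vertices.image _).union (finite_range _)

end GraphDecomposition

/-! ### Raising the height -/

namespace GraphDecomposition

variable {X : Type*} [TopologicalSpace X] (D : GraphDecomposition X) (κ : D.Edge → ℕ)

/-- The function equal to `latticeDepth (κ e)` in the parameter of each edge `e` and to `0` at the
vertices. Homeomorphisms preserving it form the transformation groups of prescribed height. -/
noncomputable def edgeDepth : X → ℕ :=
  D.glue 0 fun e => latticeDepth (κ e)

@[simp]
theorem edgeDepth_param (e : D.Edge) (t : ℝ) :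
    D.edgeDepth κ (D.param e t) = latticeDepth (κ e) t :=
  D.glue_param _ _ e t

theorem edgeDepth_of_mem_vertices {x : X} (hx : x ∈ D.vertices) : D.edgeDepth κ x = 0 :=
  D.glue_of_mem_vertices _ _ hx

variable [T2Space X]

theorem lowerSemicontinuous_edgeDepth : LowerSemicontinuous (D.edgeDepth κ) := by
  intro x j hj
  obtain hx | ⟨e, t, rfl⟩ := D.mem_vertices_or_exists_param x
  · exact absurd (hj.trans_eq (D.edgeDepth_of_mem_vertices κ hx)) (Nat.not_lt_zero j)
  · rw [D.nhds_param, eventually_map]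
    simp only [edgeDepth_param] at hj ⊢
    exact lowerSemicontinuous_latticeDepth _ t j hj

/-- The vertex preserving homeomorphisms under which `edgeDepth κ` is invariant. -/
noncomputable abbrev depthPreserving : Subgroup (X ≃ₜ X) :=
  D.vertexPreserving ⊓ preserving (D.edgeDepth κ)

variable {D κ}

theorem param_mem_orbit_depthPreserving {e : D.Edge} {s t : ℝ}
    (h : latticeDepth (κ e) s = latticeDepth (κ e) t) :
    D.param e s ∈ MulAction.orbit (D.depthPreserving κ) (D.param e t) := by
  classical
  obtain ⟨c, hc, hct⟩ := exists_orderIso_latticeDepth h.symm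
  refine mem_orbit_subgroup_iff.2 ⟨D.edgeHomeomorph (Function.update (fun _ => .refl ℝ) e c),
    ⟨D.edgeHomeomorph_mem_vertexPreserving _,
      D.edgeHomeomorph_mem_preserving fun e' t' => ?_⟩, ?_⟩
  · obtain rfl | hne := eq_or_ne e' e
    · rw [Function.update_self, edgeDepth_param, hc, edgeDepth_param]
    · rw [Function.update_of_ne hne, OrderIso.refl_apply]
  · rw [edgeHomeomorph_param, Function.update_self, hct]

theorem exists_mul_edgeHomeomorph_mem_depthPreserving
    (hκ : ∀ e t e' t', D.param e t ∈ MulAction.orbit D.vertexPreserving (D.param e' t') →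
      κ e = κ e') {f : X ≃ₜ X} (hf : f ∈ D.vertexPreserving) :
    ∃ c, f * D.edgeHomeomorph c ∈ D.depthPreserving κ := by
  obtain ⟨c, hc⟩ := exists_orderIso_straightening hf
  refine ⟨c, mul_mem hf (D.edgeHomeomorph_mem_vertexPreserving c), fun x => ?_⟩
  obtain hx | ⟨e, t, rfl⟩ := D.mem_vertices_or_exists_param x
  · rw [Homeomorph.mul_apply, D.edgeHomeomorph_of_mem_vertices c hx,
      D.edgeDepth_of_mem_vertices κ hx,
      D.edgeDepth_of_mem_vertices κ ((mem_vertices_iff_of_mem hf x).2 hx)]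
  · obtain ⟨e', u, h⟩ := hc e
    have hκe : κ e' = κ e := hκ e' (u • t) e (c e t) (mem_orbit_subgroup_iff.2 ⟨f, hf, h t⟩)
    rw [Homeomorph.mul_apply, edgeHomeomorph_param, h, edgeDepth_param, edgeDepth_param, hκe]
    obtain rfl | rfl := Int.units_eq_one_or u
    · rw [one_smul]
    · rw [Units.neg_smul, one_smul, latticeDepth_neg]

theorem mem_orbit_depthPreserving_iff
    (hκ : ∀ e t e' t', D.param e t ∈ MulAction.orbit D.vertexPreserving (D.param e' t') →
      κ e = κ e') (x y : X) :
    x ∈ MulAction.orbit (D.depthPreserving κ) y ↔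
      x ∈ MulAction.orbit D.vertexPreserving y ∧ D.edgeDepth κ x = D.edgeDepth κ y := by
  simp only [mem_orbit_subgroup_iff]
  refine ⟨fun ⟨f, hf, hfy⟩ => ⟨⟨f, hf.1, hfy⟩, hfy ▸ hf.2 y⟩, ?_⟩
  rintro ⟨⟨f, hf, rfl⟩, hdepth⟩
  obtain ⟨c, hc⟩ := exists_mul_edgeHomeomorph_mem_depthPreserving hκ hf
  obtain hy | ⟨e, t, rfl⟩ := D.mem_vertices_or_exists_param y
  · exact ⟨_, hc, congrArg f (D.edgeHomeomorph_of_mem_vertices c hy)⟩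
  · have hfc : (f * D.edgeHomeomorph c) (D.param e ((c e).symm t)) = f (D.param e t) := by
      rw [Homeomorph.mul_apply, edgeHomeomorph_param, OrderIso.apply_symm_apply]
    have ht : latticeDepth (κ e) ((c e).symm t) = latticeDepth (κ e) t := by
      rw [← edgeDepth_param, ← hc.2, hfc, hdepth, edgeDepth_param]
    obtain ⟨g, hg, hgt⟩ := mem_orbit_subgroup_iff.1 (param_mem_orbit_depthPreserving ht)
    exact ⟨_, mul_mem hc hg, (congrArg _ hgt).trans hfc⟩

theorem exists_height_eq_add (e₀ : D.Edge) (k : ℕ) :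
    ∃ G : Subgroup (X ≃ₜ X),
      height G (univ : Set X) = height D.vertexPreserving (univ : Set X) + k := by
  classical
  set O := MulAction.orbit D.vertexPreserving (D.param e₀ 0) with hO
  let κ (e : D.Edge) : ℕ := if D.param e 0 ∈ O then k else 0
  have hmem (e : D.Edge) (t : ℝ) : D.param e t ∈ O ↔ D.param e 0 ∈ O := by
    rw [hO, ← MulAction.orbit_eq_iff, ← MulAction.orbit_eq_iff,
      MulAction.orbit_eq_iff.2 (D.param_mem_orbit e t 0)]
  have hκ (e : D.Edge) (t : ℝ) (e' : D.Edge) (t' : ℝ)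
      (h : D.param e t ∈ MulAction.orbit D.vertexPreserving (D.param e' t')) : κ e = κ e' := by
    refine if_congr ?_ rfl rfl
    rw [← hmem e t, ← hmem e' t', hO, ← MulAction.orbit_eq_iff, ← MulAction.orbit_eq_iff,
      MulAction.orbit_eq_iff.2 h]
  refine ⟨D.depthPreserving κ, height_eq_add_of_orbit_split (o := D.param e₀ 0)
    (mem_orbit_depthPreserving_iff hκ) (D.lowerSemicontinuous_edgeDepth κ) (fun x hx => ?_) ?_⟩
  · obtain hxV | ⟨e, t, rfl⟩ := D.mem_vertices_or_exists_param x
    · exact D.edgeDepth_of_mem_vertices κ hxV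
    · rw [edgeDepth_param, show κ e = 0 from if_neg (mt (hmem e t).2 hx)]
      rfl
  · refine Subset.antisymm ?_ ?_
    · rintro _ ⟨x, hx, rfl⟩
      obtain hxV | ⟨e, t, rfl⟩ := D.mem_vertices_or_exists_param x
      · exact (D.edgeDepth_of_mem_vertices κ hxV).trans_le (Nat.zero_le k)
      · rw [edgeDepth_param, show κ e = k from if_pos ((hmem e t).1 hx)]
        exact range_latticeDepth k ▸ mem_range_self t
    · rw [← range_latticeDepth k]
      rintro _ ⟨t, rfl⟩
      refine ⟨D.param e₀ t, D.param_mem_orbit e₀ t 0, ?_⟩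
      rw [edgeDepth_param, show κ e₀ = k from if_pos (MulAction.mem_orbit_self _)]

end GraphDecomposition

/-! ### Removing vertices of degree two -/

section LinePoint

variable {X Y : Type*} [TopologicalSpace X] [TopologicalSpace Y]

/-- A point with an open neighborhood homeomorphic to the line. In a graph these are the edge points
and the vertices of degree two. -/
def IsLinePoint (x : X) : Prop :=
  ∃ χ : ℝ → X, IsOpenEmbedding χ ∧ χ 0 = x

theorem isLinePoint_apply_iff (f : X ≃ₜ Y) {x : X} : IsLinePoint (f x) ↔ IsLinePoint x := by
  constructor
  · rintro ⟨χ, hχ, h0⟩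
    exact ⟨f.symm ∘ χ, f.symm.isOpenEmbedding.comp hχ, f.symm_apply_eq.2 h0⟩
  · rintro ⟨χ, hχ, rfl⟩
    exact ⟨f ∘ χ, f.isOpenEmbedding.comp hχ, rfl⟩

end LinePoint

namespace GraphDecomposition

variable {X : Type*} [TopologicalSpace X] (D : GraphDecomposition X)

/-- The open half-edge: the part of an edge between its midpoint and one of its ends. -/
def halfEdge (h : D.Edge × ℤˣ) : Set X :=
  D.ray h '' Ioi 0

theorem pairwise_disjoint_halfEdge : Pairwise (Function.onFun Disjoint D.halfEdge) := by
  rintro ⟨e, u⟩ ⟨e', u'⟩ hne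
  refine disjoint_left.2 ?_
  rintro _ ⟨s, hs, rfl⟩ ⟨t, ht, h⟩
  obtain ⟨rfl, hst⟩ := D.param_inj.1 h
  refine hne (congrArg (Prod.mk e') ?_)
  rw [mem_Ioi] at hs ht
  obtain rfl | rfl := Int.units_eq_one_or u <;> obtain rfl | rfl := Int.units_eq_one_or u' <;>
    simp only [one_smul, Units.neg_smul] at hst ⊢ <;> linarith

theorem exists_mem_halfEdge {x : X} (hx : x ∉ D.vertices) (hmid : ∀ e, D.param e 0 ≠ x) :
    ∃ h, x ∈ D.halfEdge h := by
  obtain ⟨e, t, rfl⟩ := (D.mem_vertices_or_exists_param x).resolve_left hx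
  obtain ht | rfl | ht := lt_trichotomy t 0
  · exact ⟨(e, -1), -t, neg_pos.2 ht, by simp [ray]⟩
  · exact absurd rfl (hmid e)
  · exact ⟨(e, 1), t, ht, by simp [ray]⟩

variable [T2Space X]

theorem isLinePoint_param (e : D.Edge) (t : ℝ) : IsLinePoint (D.param e t) :=
  ⟨fun s => D.param e (s + t),
    (D.isOpenEmbedding_param e).comp (Homeomorph.addRight t).isOpenEmbedding,
    congrArg _ (zero_add t)⟩

theorem isOpenEmbedding_ray (h : D.Edge × ℤˣ) : IsOpenEmbedding (D.ray h) :=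
  (D.isOpenEmbedding_param h.1).comp (Homeomorph.smul h.2).isOpenEmbedding

theorem nhds_le_of_mem_vertices {v : X} (hv : v ∈ D.vertices) :
    𝓝 v ≤ pure v ⊔ ⨆ h : {h // D.endpoint h = v}, map (D.ray h) atTop := by
  refine (D.nhds_le v).trans (sup_le le_rfl (iSup_le ?_))
  rintro ⟨⟨e, t⟩, rfl⟩
  exact absurd hv (D.param_notMem_vertices e t)

theorem exists_frequently_ray_mem {v : X} (hv : v ∈ D.vertices) {C : Set X} (hvC : v ∈ closure C)
    (hv' : v ∉ C) : ∃ h, D.endpoint h = v ∧ ∃ᶠ t in atTop, D.ray h t ∈ C := by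
  by_contra! hcon
  refine mem_closure_iff_frequently.1 hvC (D.nhds_le_of_mem_vertices hv ?_)
  exact mem_sup.2 ⟨hv', mem_iSup.2 fun h => hcon h h.2⟩

theorem exists_halfEdge_of_isPreconnected {C : Set X} (hC : IsPreconnected C)
    (hCV : ∀ x ∈ C, x ∉ D.vertices) (hmid : ∀ e, D.param e 0 ∉ C) {v : X} (hv : v ∈ D.vertices)
    (hvC : v ∈ closure C) :
    ∃ h, D.endpoint h = v ∧ C ⊆ D.halfEdge h ∧ ∀ᶠ t in atTop, D.ray h t ∈ C := by
  obtain ⟨h, hend, hfreq⟩ := D.exists_frequently_ray_mem hv hvC fun hv' => hCV v hv' hv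
  obtain ⟨h', hCh'⟩ := exists_subset_of_isPreconnected
    (fun h => (D.isOpenEmbedding_ray h).isOpenMap _ isOpen_Ioi) D.pairwise_disjoint_halfEdge hC
    (closure_nonempty_iff.1 ⟨v, hvC⟩) fun x hx => mem_iUnion.2
      (D.exists_mem_halfEdge (hCV x hx) fun e he => hmid e (he ▸ hx))
  obtain ⟨a, haC, ha⟩ := (hfreq.and_eventually (eventually_gt_atTop 0)).exists
  obtain rfl : h = h' := D.pairwise_disjoint_halfEdge.eq
    (not_disjoint_iff.2 ⟨_, mem_image_of_mem _ ha, hCh' haC⟩)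
  have hord : OrdConnected (D.ray h ⁻¹' C) := by
    refine IsPreconnected.ordConnected
      ((D.isOpenEmbedding_ray h).isInducing.isPreconnected_image.1 ?_)
    rwa [image_preimage_eq_of_subset (hCh'.trans (image_subset_range _ _))]
  refine ⟨h, hend, hCh', (eventually_ge_atTop a).mono fun t hat => ?_⟩
  obtain ⟨b, htb, hb⟩ := frequently_atTop.1 hfreq t
  exact hord.out haC hb ⟨hat, htb⟩

theorem exists_pos_forall_notMem {χ : ℝ → X} (hχ : Continuous χ) (hinj : Function.Injective χ) :
    ∃ ε > 0, ∀ t, t ≠ 0 → |t| < ε → χ t ∉ D.vertices ∧ ∀ e, D.param e 0 ≠ χ t := by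
  have := D.finite_edge
  have hF : ((D.vertices ∪ range fun e => D.param e 0) \ {χ 0}).Finite :=
    (D.finite_vertices.union (finite_range _)).subset sdiff_subset
  obtain ⟨ε, hε, hball⟩ := Metric.eventually_nhds_iff.1 (hχ.continuousAt.eventually
    (hF.isClosed.isOpen_compl.mem_nhds fun h => h.2 rfl))
  have hout {t : ℝ} (ht : t ≠ 0) (htε : |t| < ε) :
      χ t ∉ D.vertices ∪ range fun e => D.param e 0 :=
    fun h => hball (by simpa using htε) ⟨h, hinj.ne ht⟩
  exact ⟨ε, hε, fun t ht htε =>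
    ⟨fun h => hout ht htε (Or.inl h), fun e h => hout ht htε (Or.inr ⟨e, h⟩)⟩⟩

theorem exists_halfEdge_of_chart {χ : ℝ → X} (hχ : Continuous χ) (h0 : χ 0 ∈ D.vertices)
    {s : Set ℝ} (hs : IsPreconnected s) (h0s : 0 ∈ closure s)
    (hsD : ∀ t ∈ s, χ t ∉ D.vertices ∧ ∀ e, D.param e 0 ≠ χ t) :
    ∃ h, D.endpoint h = χ 0 ∧ χ '' s ⊆ D.halfEdge h ∧ ∀ᶠ t in atTop, D.ray h t ∈ χ '' s := by
  refine D.exists_halfEdge_of_isPreconnected (hs.image _ hχ.continuousOn)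
    (forall_mem_image.2 fun t ht => (hsD t ht).1) ?_ h0
    (image_closure_subset_closure_image hχ (mem_image_of_mem χ h0s))
  rintro e ⟨t, ht, he⟩
  exact (hsD t ht).2 e he.symm

theorem exists_pair_endpoint_eq_iff {v : X} (hv : v ∈ D.vertices) (hline : IsLinePoint v) :
    ∃ p q, p ≠ q ∧ ∀ h, D.endpoint h = v ↔ h = p ∨ h = q := by
  obtain ⟨χ, hχ, rfl⟩ := hline
  obtain ⟨ε, hε, hD⟩ := D.exists_pos_forall_notMem hχ.continuous hχ.injective
  obtain ⟨p, hp, hpχ, hpC⟩ := D.exists_halfEdge_of_chart hχ.continuous hv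
    (isPreconnected_Ioo (a := 0) (b := ε)) (closure_Ioo hε.ne ▸ left_mem_Icc.2 hε.le)
    fun t ht => hD t ht.1.ne' (abs_lt.2 ⟨by linarith [ht.1], ht.2⟩)
  obtain ⟨q, hq, hqχ, hqC⟩ := D.exists_halfEdge_of_chart hχ.continuous hv
    (isPreconnected_Ioo (a := -ε) (b := 0))
    (closure_Ioo (neg_lt_zero.2 hε).ne ▸ right_mem_Icc.2 (neg_nonpos.2 hε.le))
    fun t ht => hD t ht.2.ne (abs_lt.2 ⟨ht.1, by linarith [ht.2]⟩)
  refine ⟨p, q, ?_, fun h => ⟨fun hh => ?_, ?_⟩⟩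
  · rintro rfl
    obtain ⟨t, ⟨a, ha, hat⟩, ⟨b, hb, hbt⟩⟩ := (hpC.and hqC).exists
    exact (hb.2.trans ha.1).ne (hχ.injective (hbt.trans hat.symm))
  · have hmem : χ '' Ioo (-ε) ε ∈ 𝓝 (D.endpoint h) :=
      hh ▸ hχ.isOpenMap.image_mem_nhds (Ioo_mem_nhds (neg_lt_zero.2 hε) hε)
    obtain ⟨t, ⟨s, hs, hst⟩, ht⟩ :=
      ((D.tendsto_ray h).eventually hmem |>.and (eventually_gt_atTop 0)).exists
    have hth : χ s ∈ D.halfEdge h := ⟨t, ht, hst.symm⟩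
    obtain hs0 | rfl | hs0 := lt_trichotomy s 0
    · exact Or.inr (D.pairwise_disjoint_halfEdge.eq
        (not_disjoint_iff.2 ⟨_, hth, hqχ ⟨s, ⟨hs.1, hs0⟩, rfl⟩⟩))
    · exact absurd (hh.trans hst) (D.endpoint_ne_param h _ _)
    · exact Or.inl (D.pairwise_disjoint_halfEdge.eq
        (not_disjoint_iff.2 ⟨_, hth, hpχ ⟨s, ⟨hs0, hs.2⟩, rfl⟩⟩))
  · rintro (rfl | rfl) <;> assumption

end GraphDecomposition

theorem eq_or_eq_iff_fst_eq {α : Type*} {p q h : α × ℤˣ} (hpq : p ≠ q) (hfst : p.1 = q.1) :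
    h = p ∨ h = q ↔ h.1 = p.1 := by
  refine ⟨?_, fun hh => ?_⟩
  · rintro (rfl | rfl)
    exacts [rfl, hfst.symm]
  · have hsnd : p.2 = -q.2 := Int.units_ne_iff_eq_neg.1 fun h => hpq (Prod.ext hfst h)
    refine (eq_or_ne h.2 p.2).imp (Prod.ext hh) fun hne => Prod.ext (hh.trans hfst) ?_
    rw [Int.units_ne_iff_eq_neg.1 hne, hsnd, neg_neg]

namespace GraphDecomposition

variable {X : Type*} [TopologicalSpace X] (D : GraphDecomposition X)

theorem isOpen_of_param [T2Space X] {S : Set X} (hparam : ∀ e, IsOpen (D.param e ⁻¹' S))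
    (hray : ∀ h, D.endpoint h ∈ S → ∀ᶠ t in atTop, D.ray h t ∈ S) : IsOpen S := by
  refine isOpen_iff_mem_nhds.2 fun x hx => D.nhds_le x ?_
  refine mem_sup.2 ⟨mem_sup.2 ⟨hx, mem_iSup.2 ?_⟩, mem_iSup.2 ?_⟩
  · rintro ⟨h, rfl⟩
    exact hray h hx
  · rintro ⟨⟨e, t⟩, rfl⟩
    exact (hparam e).mem_nhds hx

theorem isOpen_of_mem_iff [T2Space X] {S : Set X} {E : Set D.Edge}
    (hparam : ∀ e t, D.param e t ∈ S ↔ e ∈ E) (hend : ∀ h, D.endpoint h ∈ S ↔ h.1 ∈ E) :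
    IsOpen S := by
  refine D.isOpen_of_param (fun e => ?_) fun h hh => Eventually.of_forall fun t => ?_
  · simp only [preimage, hparam, isOpen_const]
  · exact (hparam _ _).2 ((hend h).1 hh)

theorem isClopen_of_mem_iff [T2Space X] {S : Set X} {E : Set D.Edge}
    (hparam : ∀ e t, D.param e t ∈ S ↔ e ∈ E) (hend : ∀ h, D.endpoint h ∈ S ↔ h.1 ∈ E) :
    IsClopen S :=
  ⟨isOpen_compl_iff.1 (D.isOpen_of_mem_iff (E := Eᶜ) (fun e t => not_congr (hparam e t))
    fun h => not_congr (hend h)), D.isOpen_of_mem_iff hparam hend⟩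

variable {D}
variable {p q : D.Edge × ℤˣ} {v : X}

theorem range_param_eq_compl_singleton [T2Space X] [PreconnectedSpace X] (hpq : p ≠ q)
    (hedge : p.1 = q.1) (hends : ∀ h, D.endpoint h = v ↔ h = p ∨ h = q) :
    range (D.param p.1) = {v}ᶜ := by
  have hv (e : D.Edge) (t : ℝ) : D.param e t ≠ v :=
    (hends p).2 (Or.inl rfl) ▸ (D.endpoint_ne_param p e t).symm
  have hclopen : IsClopen (insert v (range (D.param p.1))) := by
    refine D.isClopen_of_mem_iff (E := {p.1}) (fun e t => ?_) fun h => ?_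
    · rw [mem_insert_iff, or_iff_right (hv e t), mem_singleton_iff]
      exact ⟨fun ⟨s, hs⟩ => (D.param_inj.1 hs).1.symm, fun he => ⟨t, he ▸ rfl⟩⟩
    · have hrange : D.endpoint h ∉ range (D.param p.1) := by
        rintro ⟨t, ht⟩
        exact D.endpoint_ne_param h _ _ ht.symm
      rw [mem_insert_iff, or_iff_left hrange, hends, eq_or_eq_iff_fst_eq hpq hedge,
        mem_singleton_iff]
  have huniv := hclopen.eq_univ ⟨v, mem_insert _ _⟩
  refine Subset.antisymm (range_subset_iff.2 fun t => hv p.1 t) fun x hx => ?_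
  exact (huniv.superset (mem_univ x)).resolve_left hx

variable (D) in
/-- A half-edge reparametrized by `t ↦ -log |t|`, so that its end becomes the value at `0`. -/
noncomputable def capped (h : D.Edge × ℤˣ) : ℝ → X :=
  Function.update (fun t => D.ray h (-Real.log t)) 0 (D.endpoint h)

theorem capped_zero (h : D.Edge × ℤˣ) : D.capped h 0 = D.endpoint h :=
  Function.update_self ..

theorem capped_of_ne {t : ℝ} (ht : t ≠ 0) (h : D.Edge × ℤˣ) :
    D.capped h t = D.ray h (-Real.log t) :=
  Function.update_of_ne ht ..

theorem continuous_capped (h : D.Edge × ℤˣ) : Continuous (D.capped h) := by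
  refine continuous_iff_continuousAt.2 fun t => ?_
  obtain rfl | ht := eq_or_ne t 0
  · exact continuousAt_update_same.2 ((D.tendsto_ray h).comp
      (tendsto_neg_atBot_atTop.comp Real.tendsto_log_nhdsNE_zero))
  · exact (continuousAt_update_of_ne ht).2 ((D.continuous_ray h).continuousAt.comp
      (Real.continuousAt_log ht).neg)

variable (D) in
/-- The half-edges `p` and `q` with a common end, joined to a line on which this end is `0`. -/
noncomputable def join (p q : D.Edge × ℤˣ) (t : ℝ) : X :=
  if t ≤ 0 then D.capped p t else D.capped q t

theorem continuous_join (h : D.endpoint p = D.endpoint q) : Continuous (D.join p q) :=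
  (continuous_capped p).if_le (continuous_capped q) continuous_id continuous_const
    fun t (ht : t = 0) => by rw [ht, capped_zero, capped_zero, h]

theorem join_of_neg {t : ℝ} (ht : t < 0) : D.join p q t = D.ray p (-Real.log t) := by
  rw [join, if_pos ht.le, capped_of_ne ht.ne]

theorem join_of_pos {t : ℝ} (ht : 0 < t) : D.join p q t = D.ray q (-Real.log t) := by
  rw [join, if_neg ht.not_ge, capped_of_ne ht.ne']

theorem join_zero : D.join p q 0 = D.endpoint p := by
  rw [join, if_pos le_rfl, capped_zero]

theorem injective_ray (h : D.Edge × ℤˣ) : Function.Injective (D.ray h) :=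
  (D.injective_param_edge h.1).comp (MulAction.injective h.2)

theorem range_ray (h : D.Edge × ℤˣ) : range (D.ray h) = range (D.param h.1) :=
  (MulAction.surjective h.2).range_comp (D.param h.1)

theorem injective_join (hedge : p.1 ≠ q.1) : Function.Injective (D.join p q) := by
  have hray (s t : ℝ) : D.ray p s ≠ D.ray q t := fun h => hedge (D.param_inj.1 h).1
  have hend (h : D.Edge × ℤˣ) (t : ℝ) : D.endpoint p ≠ D.ray h t := D.endpoint_ne_param p _ _
  intro s t h
  obtain hs | rfl | hs := lt_trichotomy s 0 <;> obtain ht | rfl | ht := lt_trichotomy t 0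
  · rw [join_of_neg hs, join_of_neg ht, ← Real.log_neg_eq_log s, ← Real.log_neg_eq_log t] at h
    exact neg_injective
      (Real.log_injOn_pos (neg_pos.2 hs) (neg_pos.2 ht) (neg_injective (injective_ray p h)))
  · exact absurd (by rwa [join_of_neg hs, join_zero, eq_comm] at h) (hend _ _)
  · exact absurd (by rwa [join_of_neg hs, join_of_pos ht] at h) (hray _ _)
  · exact absurd (by rwa [join_of_neg ht, join_zero] at h) (hend _ _)
  · rfl
  · exact absurd (by rwa [join_of_pos ht, join_zero] at h) (hend _ _)
  · exact absurd (by rwa [join_of_pos hs, join_of_neg ht, eq_comm] at h) (hray _ _)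
  · exact absurd (by rwa [join_of_pos hs, join_zero, eq_comm] at h) (hend _ _)
  · rw [join_of_pos hs, join_of_pos ht] at h
    exact Real.log_injOn_pos hs ht (neg_injective (injective_ray q h))

theorem range_join :
    range (D.join p q) =
      insert (D.endpoint p) (range (D.param p.1) ∪ range (D.param q.1)) := by
  rw [← range_ray p, ← range_ray q]
  refine Subset.antisymm ?_ (insert_subset ⟨0, join_zero⟩ (union_subset ?_ ?_))
  · rintro _ ⟨t, rfl⟩
    obtain ht | rfl | ht := lt_trichotomy t 0
    · exact Or.inr (Or.inl ⟨_, (join_of_neg ht).symm⟩)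
    · exact Or.inl join_zero
    · exact Or.inr (Or.inr ⟨_, (join_of_pos ht).symm⟩)
  · rintro _ ⟨t, rfl⟩
    exact ⟨-Real.exp (-t), by
      rw [join_of_neg (neg_lt_zero.2 (Real.exp_pos _)), Real.log_neg_eq_log, Real.log_exp, neg_neg]⟩
  · rintro _ ⟨t, rfl⟩
    exact ⟨Real.exp (-t), by rw [join_of_pos (Real.exp_pos _), Real.log_exp, neg_neg]⟩

theorem tendsto_join_atTop :
    Tendsto (D.join p q) atTop (𝓝 (D.endpoint (q.1, -q.2))) := by
  refine ((D.tendsto_ray (q.1, -q.2)).comp Real.tendsto_log_atTop).congr' ?_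
  filter_upwards [eventually_gt_atTop 0] with t ht
  rw [join_of_pos ht, Function.comp_apply, ray, ray, Units.neg_smul, smul_neg]

theorem tendsto_join_neg_atTop :
    Tendsto (fun t => D.join p q (-t)) atTop (𝓝 (D.endpoint (p.1, -p.2))) := by
  refine ((D.tendsto_ray (p.1, -p.2)).comp Real.tendsto_log_atTop).congr' ?_
  filter_upwards [eventually_gt_atTop 0] with t ht
  rw [join_of_neg (neg_lt_zero.2 ht), Real.log_neg_eq_log, Function.comp_apply, ray, ray,
    Units.neg_smul, smul_neg]

variable (D) in
/-- The edges left when those of the half-edges `p` and `q` are joined; `none` is the joined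
edge. -/
abbrev MergedEdge (p q : D.Edge × ℤˣ) : Type :=
  Option {e : D.Edge // e ≠ p.1 ∧ e ≠ q.1}

variable (D) in
/-- The parametrizations of the edges left when those of `p` and `q` are joined. -/
noncomputable def mergedParam (p q : D.Edge × ℤˣ) : D.MergedEdge p q → ℝ → X
  | none => D.join p q
  | some e => D.param e

variable (D) in
/-- The ends of the edges left when those of `p` and `q` are joined. -/
def mergedEndpoint (p q : D.Edge × ℤˣ) : D.MergedEdge p q × ℤˣ → X
  | (none, u) => if u = 1 then D.endpoint (q.1, -q.2) else D.endpoint (p.1, -p.2)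
  | (some e, u) => D.endpoint (e, u)

theorem injective_mergedParam (hedge : p.1 ≠ q.1) :
    Function.Injective (Function.uncurry (D.mergedParam p q)) := by
  have hjoin (e : {e : D.Edge // e ≠ p.1 ∧ e ≠ q.1}) (s t : ℝ) :
      D.join p q s ≠ D.param e t := by
    intro h
    obtain he | ⟨r, hr⟩ | ⟨r, hr⟩ := range_join.subset (mem_range_self (f := D.join p q) s)
    · exact D.endpoint_ne_param p _ _ (he.symm.trans h)
    · exact e.2.1 (D.param_inj.1 (hr.trans h)).1.symm
    · exact e.2.2 (D.param_inj.1 (hr.trans h)).1.symm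
  rintro ⟨_ | e, s⟩ ⟨_ | e', t⟩ h
  · exact congrArg _ (injective_join hedge h)
  · exact absurd h (hjoin e' s t)
  · exact absurd h.symm (hjoin e t s)
  · obtain ⟨he, rfl⟩ := D.param_inj.1 h
    rw [Subtype.ext he]

theorem range_mergedParam (hp : D.endpoint p = v) :
    range (Function.uncurry (D.mergedParam p q)) = (D.vertices \ {v})ᶜ := by
  subst hp
  ext x
  have hx : x ∈ range (Function.uncurry (D.mergedParam p q)) ↔
      x ∈ range (D.join p q) ∨ ∃ e : {e // e ≠ p.1 ∧ e ≠ q.1}, x ∈ range (D.param e) := by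
    simp only [mem_range, Prod.exists, Option.exists]
    rfl
  have hxD : x ∈ D.verticesᶜ ↔ ∃ e, x ∈ range (D.param e) := by
    rw [← D.range_param, mem_range, Prod.exists]
    rfl
  rw [hx, range_join, Set.compl_sdiff, mem_union, mem_singleton_iff, hxD, mem_insert_iff, mem_union]
  constructor
  · rintro ((rfl | h | h) | ⟨e, h⟩)
    exacts [Or.inl rfl, Or.inr ⟨_, h⟩, Or.inr ⟨_, h⟩, Or.inr ⟨_, h⟩]
  · rintro (rfl | ⟨e, h⟩)
    · exact Or.inl (Or.inl rfl)
    · by_cases he : e ≠ p.1 ∧ e ≠ q.1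
      · exact Or.inr ⟨⟨e, he⟩, h⟩
      · obtain rfl | rfl := not_and_or.1 he |>.imp not_not.1 not_not.1
        exacts [Or.inl (Or.inr (Or.inl h)), Or.inl (Or.inr (Or.inr h))]

theorem mergedEndpoint_mem (hedge : p.1 ≠ q.1)
    (hends : ∀ h, D.endpoint h = v ↔ h = p ∨ h = q) (h : D.MergedEdge p q × ℤˣ) :
    D.mergedEndpoint p q h ∈ D.vertices \ {v} := by
  have hmem {h : D.Edge × ℤˣ} (hp : h ≠ p) (hq : h ≠ q) : D.endpoint h ∈ D.vertices \ {v} :=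
    ⟨D.endpoint_mem h, fun hv => ((hends h).1 hv).elim hp hq⟩
  have hneg (h : D.Edge × ℤˣ) : (h.1, -h.2) ≠ h := fun hh =>
    units_ne_neg_self h.2 (congrArg Prod.snd hh).symm
  obtain ⟨_ | e, u⟩ := h
  · rw [mergedEndpoint]
    split_ifs
    · exact hmem (fun h => hedge (congrArg Prod.fst h).symm) (hneg q)
    · exact hmem (hneg p) fun h => hedge (Prod.ext_iff.1 h).1
  · exact hmem (fun h => e.2.1 (congrArg Prod.fst h)) fun h => e.2.2 (congrArg Prod.fst h)

theorem tendsto_mergedParam (h : D.MergedEdge p q × ℤˣ) :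
    Tendsto (fun t : ℝ => D.mergedParam p q h.1 (h.2 • t)) atTop (𝓝 (D.mergedEndpoint p q h)) := by
  obtain ⟨_ | e, u⟩ := h
  · obtain rfl | rfl := Int.units_eq_one_or u
    · simpa [mergedParam, mergedEndpoint] using tendsto_join_atTop (D := D)
    · simpa [mergedParam, mergedEndpoint] using tendsto_join_neg_atTop (D := D)
  · exact D.tendsto_param (e, u)

/-- The decomposition without the vertex `v` of degree two, at which exactly the half-edges `p` and
`q` of two distinct edges end. -/
noncomputable def merge (hedge : p.1 ≠ q.1) (hends : ∀ h, D.endpoint h = v ↔ h = p ∨ h = q) :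
    GraphDecomposition X where
  vertices := D.vertices \ {v}
  Edge := D.MergedEdge p q
  param := D.mergedParam p q
  endpoint := D.mergedEndpoint p q
  finite_vertices := D.finite_vertices.subset sdiff_subset
  finite_edge := have := D.finite_edge; inferInstance
  continuous_param
    | none => continuous_join (((hends p).2 (Or.inl rfl)).trans ((hends q).2 (Or.inr rfl)).symm)
    | some e => D.continuous_param e
  injective_param := injective_mergedParam hedge
  range_param := range_mergedParam ((hends p).2 (Or.inl rfl))
  endpoint_mem := mergedEndpoint_mem hedge hends
  tendsto_param := tendsto_mergedParam

theorem exists_forall_not_isLinePoint_or_range_param_eq [T2Space X] [PreconnectedSpace X]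
    (D : GraphDecomposition X) :
    ∃ D' : GraphDecomposition X, (∀ v ∈ D'.vertices, ¬IsLinePoint v) ∨
      ∃ v e, range (D'.param e) = {v}ᶜ := by
  induction hn : D.vertices.ncard using Nat.strong_induction_on generalizing D with | _ n ih
  by_cases! hall : ∀ v ∈ D.vertices, ¬IsLinePoint v
  · exact ⟨D, Or.inl hall⟩
  obtain ⟨v, hv, hline⟩ := hall
  obtain ⟨p, q, hpq, hends⟩ := D.exists_pair_endpoint_eq_iff hv hline
  by_cases hedge : p.1 = q.1
  · exact ⟨D, Or.inr ⟨v, p.1, range_param_eq_compl_singleton hpq hedge hends⟩⟩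
  · exact ih _ (hn ▸ ncard_sdiff_singleton_lt_of_mem hv D.finite_vertices) (merge hedge hends) rfl

end GraphDecomposition

/-! ### Topological graphs -/

theorem range_uncurry_comp_sigmoid {ι X : Type*} {φ : ι → unitInterval → X}
    (hinj : ∀ i, Function.Injective (φ i)) (hsurj : ∀ x, ∃ i t, φ i t = x)
    (hcross : ∀ i j s t, φ i s = φ j t → s ∈ Ioo 0 1 → i = j) :
    range (Function.uncurry fun i t => φ i (unitInterval.sigmoid t)) =
      (range (φ · 0) ∪ range (φ · 1))ᶜ := by
  ext x
  constructor
  · rintro ⟨⟨i, s⟩, rfl⟩ h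
    have hs : unitInterval.sigmoid s ∈ Ioo 0 1 := unitInterval.range_sigmoid.subset ⟨s, rfl⟩
    obtain ⟨j, h⟩ | ⟨j, h⟩ := h <;> obtain rfl : i = j := hcross i j _ _ h.symm hs
    · exact hs.1.ne (hinj i h)
    · exact hs.2.ne' (hinj i h)
  · intro hx
    obtain ⟨i, t, rfl⟩ := hsurj x
    have ht0 : t ≠ 0 := fun h => hx (Or.inl ⟨i, congrArg (φ i) h.symm⟩)
    have ht1 : t ≠ 1 := fun h => hx (Or.inr ⟨i, congrArg (φ i) h.symm⟩)
    obtain ⟨s, rfl⟩ := unitInterval.range_sigmoid.superset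
      ⟨unitInterval.pos_iff_ne_zero.2 ht0, unitInterval.lt_one_iff_ne_one.2 ht1⟩
    exact ⟨(i, s), rfl⟩

namespace GraphDecomposition

variable {X : Type*} [TopologicalSpace X]

/-- The decomposition of a space covered by finitely many arcs without interior crossings: the
vertices are the end points, and `sigmoid` identifies the line with the interior of `[0,1]`. -/
noncomputable def ofArcs {ι : Type} [Finite ι] {φ : ι → unitInterval → X}
    (hφ : ∀ i, Continuous (φ i)) (hinj : ∀ i, Function.Injective (φ i))
    (hsurj : ∀ x, ∃ i t, φ i t = x)
    (hcross : ∀ i j s t, φ i s = φ j t → s ∈ Ioo 0 1 → i = j) : GraphDecomposition X where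
  vertices := range (φ · 0) ∪ range (φ · 1)
  Edge := ι
  param i t := φ i (unitInterval.sigmoid t)
  endpoint h := if h.2 = 1 then φ h.1 1 else φ h.1 0
  finite_vertices := (finite_range _).union (finite_range _)
  finite_edge := ‹_›
  continuous_param i := (hφ i).comp unitInterval.continuous_sigmoid
  injective_param := by
    rintro ⟨i, s⟩ ⟨j, t⟩ h
    obtain rfl : i = j := hcross i j _ _ h (unitInterval.range_sigmoid.subset ⟨s, rfl⟩)
    exact congrArg (Prod.mk i) (unitInterval.sigmoid_injective (hinj i h))
  range_param := range_uncurry_comp_sigmoid hinj hsurj hcross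
  endpoint_mem h := by
    split_ifs
    · exact Or.inr ⟨h.1, rfl⟩
    · exact Or.inl ⟨h.1, rfl⟩
  tendsto_param := by
    rintro ⟨i, u⟩
    obtain rfl | rfl := Int.units_eq_one_or u
    · simpa [Function.comp_def] using ((hφ i).tendsto 1).comp unitInterval.tendsto_sigmoid_atTop
    · simpa [Function.comp_def] using ((hφ i).tendsto 0).comp
        (unitInterval.tendsto_sigmoid_atBot.comp tendsto_neg_atTop_atBot)

variable (D : GraphDecomposition X)

theorem nonempty_edge [Infinite X] : Nonempty D.Edge := by
  by_contra! hempty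
  refine infinite_univ (D.finite_vertices.subset fun x _ => ?_)
  exact (D.mem_vertices_or_exists_param x).resolve_right fun ⟨e, _⟩ => hempty.elim e

variable [T2Space X]

theorem height_vertexPreserving_lt_top [Nonempty X] :
    height D.vertexPreserving (univ : Set X) < ⊤ := by
  refine lt_of_le_of_lt le_self_add (b := height D.vertexPreserving (univ : Set X) + 1) ?_
  rw [height_add_one_eq_card]
  exact ENat.natCast_lt_top _

variable {D}

theorem height_vertexPreserving_of_forall_not_isLinePoint
    (h : ∀ v ∈ D.vertices, ¬IsLinePoint v) :
    height D.vertexPreserving (univ : Set X) = height (X ≃ₜ X) (univ : Set X) := by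
  have hvertex (x : X) : x ∈ D.vertices ↔ ¬IsLinePoint x := by
    refine ⟨h x, fun hx => (D.mem_vertices_or_exists_param x).resolve_right ?_⟩
    rintro ⟨e, t, rfl⟩
    exact hx (D.isLinePoint_param e t)
  have hall (f : X ≃ₜ X) : f ∈ D.vertexPreserving := fun x =>
    propext ((hvertex _).trans ((not_congr (isLinePoint_apply_iff f)).trans (hvertex x).symm))
  exact height_congr (fun g => ⟨g.1, fun _ => rfl⟩) (fun f => ⟨⟨f, hall f⟩, fun _ => rfl⟩) _

theorem height_vertexPreserving_le_one {v : X} {e : D.Edge} (h : range (D.param e) = {v}ᶜ) :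
    height D.vertexPreserving (univ : Set X) ≤ 1 := by
  have : Nonempty X := ⟨v⟩
  have huniv : (univ : Set (Quotient (MulAction.orbitRel D.vertexPreserving X))) ⊆
      {Quotient.mk _ v, Quotient.mk _ (D.param e 0)} := by
    rintro q -
    obtain ⟨x, rfl⟩ := Quotient.mk_surjective q
    by_cases hx : x = v
    · exact Or.inl (congrArg _ hx)
    · obtain ⟨t, rfl⟩ := h.superset hx
      exact Or.inr (mk_eq_mk_iff_mem_orbit.2 (D.param_mem_orbit e t 0))
  have hcard : Nat.card (Quotient (MulAction.orbitRel D.vertexPreserving X)) ≤ 1 + 1 :=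
    ncard_univ (Quotient (MulAction.orbitRel D.vertexPreserving X)) ▸
      (ncard_le_ncard huniv).trans ((ncard_insert_le _ _).trans_eq (by rw [ncard_singleton]))
  refine (ENat.add_le_add_iff_right ENat.one_ne_top).1 ?_
  rw [height_add_one_eq_card]
  exact_mod_cast hcard

theorem exists_height_vertexPreserving_le [PreconnectedSpace X] (D : GraphDecomposition X) :
    ∃ D' : GraphDecomposition X,
      height D'.vertexPreserving (univ : Set X) ≤ height (X ≃ₜ X) (univ : Set X) + 1 := by
  obtain ⟨D', hD' | ⟨v, e, he⟩⟩ := D.exists_forall_not_isLinePoint_or_range_param_eq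
  · exact ⟨D', (height_vertexPreserving_of_forall_not_isLinePoint hD').le.trans le_self_add⟩
  · exact ⟨D', (height_vertexPreserving_le_one he).trans le_add_self⟩

end GraphDecomposition

namespace IsTopologicalGraph

variable {X : Type*} [TopologicalSpace X]

theorem infinite (hX : IsTopologicalGraph X) : Infinite X := by
  obtain ⟨n, A, a, b, hA, hcover, -⟩ := hX.exists_arcs
  obtain ⟨x⟩ := hX.connectedSpace.toNonempty
  obtain ⟨i, -⟩ := mem_iUnion.1 (hcover ▸ mem_univ x)
  obtain ⟨φ, -⟩ := hA i
  have : Infinite unitInterval := infinite_coe_iff.2 (Icc_infinite zero_lt_one)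
  exact Infinite.of_injective _ (Subtype.val_injective.comp φ.injective)

theorem nonempty_graphDecomposition (hX : IsTopologicalGraph X) :
    Nonempty (GraphDecomposition X) := by
  obtain ⟨n, A, a, b, hA, hcover, hinter⟩ := hX.exists_arcs
  choose φ hφ0 hφ1 using hA
  refine ⟨.ofArcs (φ := fun i t => φ i t)
    (fun i => continuous_subtype_val.comp (φ i).continuous)
    (fun i => Subtype.val_injective.comp (φ i).injective) (fun x => ?_) fun i j s t h hs => ?_⟩
  · obtain ⟨i, hi⟩ := mem_iUnion.1 (hcover ▸ mem_univ x)
    exact ⟨i, (φ i).symm ⟨x, hi⟩, congrArg Subtype.val ((φ i).apply_symm_apply _)⟩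
  · by_contra hij
    obtain hend | hend := (hinter i j hij ⟨(φ i s).2, h ▸ (φ j t).2⟩).1
    · exact hs.1.ne' ((φ i).injective (Subtype.ext (hend.trans (hφ0 i).symm)))
    · exact hs.2.ne ((φ i).injective (Subtype.ext (hend.trans (hφ1 i).symm)))

theorem exists_height_eq_add (hX : IsTopologicalGraph X) :
    height (X ≃ₜ X) (univ : Set X) < ⊤ ∧ ∀ k : ℕ, ∃ G : Subgroup (X ≃ₜ X),
      height G (univ : Set X) = height (X ≃ₜ X) (univ : Set X) + k := by
  have := hX.connectedSpace
  have := hX.metrizableSpace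
  have := hX.infinite
  obtain ⟨D₀⟩ := hX.nonempty_graphDecomposition
  obtain ⟨D, hD⟩ := D₀.exists_height_vertexPreserving_le
  obtain ⟨e₀⟩ := D.nonempty_edge
  have hle (G : Subgroup (X ≃ₜ X)) : height (X ≃ₜ X) (univ : Set X) ≤ height G (univ : Set X) :=
    height_le_height (fun g => ⟨g.1, fun _ => rfl⟩) _
  have hlt := (hle D.vertexPreserving).trans_lt D.height_vertexPreserving_lt_top
  refine ⟨hlt, fun k => ?_⟩
  obtain ⟨c, hc⟩ := exists_add_of_le (hle D.vertexPreserving)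
  have hc1 : c ≤ 1 := (ENat.add_le_add_iff_left hlt.ne).1 (hc ▸ hD)
  cases k with
  | zero =>
    refine ⟨⊤, ?_⟩
    rw [Nat.cast_zero, add_zero]
    exact height_congr (fun g => ⟨g.1, fun _ => rfl⟩)
      (fun f => ⟨⟨f, Subgroup.mem_top f⟩, fun _ => rfl⟩) _
  | succ k =>
    lift c to ℕ using ne_top_of_le_ne_top ENat.one_ne_top hc1
    obtain ⟨d, hd⟩ := Nat.exists_eq_add_of_le ((Nat.cast_le_one.1 hc1).trans (Nat.le_add_left 1 k))
    obtain ⟨G, hG⟩ := D.exists_height_eq_add e₀ d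
    exact ⟨G, by rw [hG, hc, add_assoc, hd, Nat.cast_add]⟩

end IsTopologicalGraph

end TransformationGroup

theorem mainTheorem2 {X : Type*} [TopologicalSpace X]
    (hX : TransformationGroup.IsTopologicalGraph X) :
    TransformationGroup.height (X ≃ₜ X) (Set.univ : Set X) < ⊤ ∧
    TransformationGroup.possibleHeights X =
      {h : ℕ∞ | ∃ k : ℕ, h = TransformationGroup.height (X ≃ₜ X) (Set.univ : Set X) + k} ∪
        {⊤} := by
  open TransformationGroup in
  obtain ⟨hlt, hadd⟩ := hX.exists_height_eq_add
  refine ⟨hlt, Set.Subset.antisymm ?_ ?_⟩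
  · intro h hh
    obtain ⟨G, rfl⟩ := mem_possibleHeights_iff.1 hh
    have hle : height (X ≃ₜ X) (Set.univ : Set X) ≤ height G (Set.univ : Set X) :=
      height_le_height (fun g => ⟨g.1, fun _ => rfl⟩) _
    by_cases htop : height G (Set.univ : Set X) = ⊤
    · exact Or.inr htop
    · obtain ⟨c, hc⟩ := exists_add_of_le hle
      have hc' : c ≠ ⊤ := by
        rintro rfl
        exact htop (by rw [hc, add_top])
      lift c to ℕ using hc'
      exact Or.inl ⟨c, hc⟩
  · rintro h (⟨k, rfl⟩ | rfl)
    · obtain ⟨G, hG⟩ := hadd k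
      exact mem_possibleHeights_iff.2 ⟨G, hG.symm⟩
    · have := hX.infinite
      have := hX.metrizableSpace
      refine mem_possibleHeights_iff.2 ⟨⊥, (height_eq_top_of_trivial fun g x => ?_).symm⟩
      obtain rfl : g = 1 := Subsingleton.elim _ _
      exact one_smul _ x
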